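/- **Theorem (the smooth limit).** *Conventions.* A prespectral triple $(A,H)$ is a finite-dimensional unital $*$-algebra $A$ acting faithfully by a $*$-action $\lambda$ on a finite-dimensional Hilbert space $H$; a morphism $(\phi,L):(A,H)\to(A',H')$ is a $*$-algebra map $\phi:A\to A'$ with a unitary $L:H\to H'$ such that $\lambda'(\phi(x))=L\lambda(x)L^*$ for all $x \in A$. A representation of a quiver $Q$ assigns a prespectral triple $(A_v,H_v)$ to each vertex and a morphism $(\phi_e,L_e):(A_{s(e)},H_{s(e)})\to(A_{t(e)},H_{t(e)})$ to each edge. Given edge lengths $\rho(e)>0$, its Dirac operator on $\bigoplus_v H_v$ is $D=\sum_{e}\rho(e)^{-1}(L_e+L_e^*)$, where $L_e$ and $L_e^*$ are extended by zero. The quiver $O^d_m$ has the vertices $(\mathbb Z/m\mathbb Z)^d$, one edge from $v$ to $v+\mathbf e_j$ for each $v$ and each $j=1,\dots,d$, and one self-loop $o_v$ at each $v$; put $\varphi_v=\rho(o_v)^{-1}(L_{o_v}+L_{o_v}^*)$. Let $d\ge 2$, $N\ge 1$, $\ell>0$, and let $f(x)=\sum_{k=0}^4 f_kx^k$ be a real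 polynomial. Let $h,A_1,\dots,A_d$ be smooth hermitian $M_N(\mathbb C)$-valued fields on the torus $\mathbb T^d=\mathbb R^d/(\ell\mathbb Z)^d$, of volume $\ell^d$. For $m\geq 1$ let $a=\ell/m$ be the lattice spacing, $\Lambda=1/a$, and identify the vertex $v$ of $O^d_m$ with the point $av\in\mathbb T^d$. Let $R$ be a representation of $O^d_m$ in prespectral triples with $(A_{v_0},H_{v_0})\cong(M_N(\mathbb C),\mathbb C^N)$ for some vertex $v_0$. Then $(A_v,H_v)\cong(M_N(\mathbb C),\mathbb C^N)$ for every vertex $v$. Suppose further that $\rho=a$ on the edges that are not self-loops, that $\rho(o_v)>0$ is arbitrary, and that in suitable orthonormal frames $H_v\cong\mathbb C^N$ one has $\varphi_v=h(av)$ and the block of $aD$ which the edge $e=(v,v+\mathbf e_j)$ contributes from $H_{v+\mathbf e_j}$ to $H_v$ (that is, $L_e^*$) is $\exp(\mathrm i aA_j(av))$. Then, as $m\to\infty$, i.e. $a\to0^+$, $$\begin{aligned}\operatorname{Tr} f(D/\Lambda)={}&\Lambda^{d}N\,[f_0+2d f_2+(12d^2-6d)f_4]\operatorname{vol}(\mathbb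 T^d)-2\Lambda^{d-4}f_4\int_{\mathbb T^d}\sum_{i,j=1}^d\operatorname{Tr}_N(F_{ij}^2)\,d^dx\\&-\int_{\mathbb T^d}\operatorname{Tr}_N\Big\{2\Lambda^{d-4}f_4\sum_{j=1}^d(D_jh)^2-\Lambda^{d-2}(f_2+12d f_4)h^2-\Lambda^{d-4}f_4h^4\Big\}d^dx\\&+\int_{\mathbb T^d}\operatorname{Tr}_N\Big\{\Lambda^{d-1}(f_1+6d f_3)h+\Lambda^{d-3}f_3h^3\Big\}d^dx+O(\Lambda^{d-5}),\end{aligned}$$ where $D_jh=\partial_jh+[\mathrm iA_j,h]$ and $F_{ij}=\partial_iA_j-\partial_jA_i+\mathrm i[A_i,A_j]$. The constant in $O(\Lambda^{d-5})$ depends only on $d,N,\ell,f,h,A_1,\dots,A_d$, not on $m$ or on the representation $R$. (For even $f$, i.e. $f_1=f_3=0$, the last integral is absent.) -/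

import Mathlib

open CategoryTheory
open scoped ContDiff

noncomputable section

/-! ## Prespectral triples -/

/-- A prespectral triple `(A, λ, H)`: a finite-dimensional unital `*`-algebra `A` acting faithfully,
by a `*`-action `λ = act`, on a finite-dimensional Hilbert space `H`.
(The star of `Module.End ℂ H` is the adjoint.) -/
structure PrespectralTriple where
  A : Type
  H : Type
  [ring : Ring A]
  [algebra : Algebra ℂ A]
  [starRing : StarRing A]
  [starModule : StarModule ℂ A]
  [finAlg : FiniteDimensional ℂ A]
  [normed : NormedAddCommGroup H]
  [inner : InnerProductSpace ℂ H]
  [finHilb : FiniteDimensional ℂ H]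
  act : A →⋆ₐ[ℂ] Module.End ℂ H
  faithful : Function.Injective act

namespace PrespectralTriple

attribute [instance] ring algebra starRing starModule finAlg normed inner finHilb

/-- A morphism `(φ, L)`: a `*`-algebra map `φ` and a unitary `L` with `λ'(φ(a)) = L λ(a) L*`. -/
@[ext]
structure Hom (X Y : PrespectralTriple) where
  algMap : X.A →⋆ₐ[ℂ] Y.A
  trans : X.H ≃ₗᵢ[ℂ] Y.H
  compat : ∀ (a : X.A) (ψ : Y.H), Y.act (algMap a) ψ = trans (X.act a (trans.symm ψ))

instance : Category PrespectralTriple where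
  Hom := Hom
  id X :=
    { algMap := StarAlgHom.id ℂ X.A
      trans := LinearIsometryEquiv.refl ℂ X.H
      compat := fun _ _ => rfl }
  comp {X Y Z} S T :=
    { algMap := T.algMap.comp S.algMap
      trans := S.trans.trans T.trans
      compat := fun a ψ => by
        have h1 := T.compat (S.algMap a) ψ
        have h2 := S.compat a (T.trans.symm ψ)
        rw [h2] at h1
        exact h1 }
  id_comp _ := rfl
  comp_id _ := rfl
  assoc _ _ _ := rfl

/-- The prespectral triple `(M_N(ℂ), ℂ^N)`, matrices acting on column vectors. -/
def matrixTriple (N : ℕ) : PrespectralTriple where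
  A := Matrix (Fin N) (Fin N) ℂ
  H := EuclideanSpace ℂ (Fin N)
  act := ((LinearMap.toMatrixOrthonormal (EuclideanSpace.basisFun (Fin N) ℂ)).symm :
    Matrix (Fin N) (Fin N) ℂ →⋆ₐ[ℂ] Module.End ℂ (EuclideanSpace ℂ (Fin N)))
  faithful := (LinearMap.toMatrixOrthonormal (EuclideanSpace.basisFun (Fin N) ℂ)).symm.injective

end PrespectralTriple

/-! ## Quiver representations and their Dirac operator -/

/-- A representation of a quiver in prespectral triples: a triple `X_v` for each vertex and a
morphism `(φ_e, L_e) : X_{s(e)} ⟶ X_{t(e)}` for each edge. (By the universal property of the free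
category these are the functors from the path category to prespectral triples.) -/
abbrev QuiverRep (V : Type) [Quiver.{0} V] := V ⥤q PrespectralTriple

/-- Assignments of a length to each edge of a quiver (graph distances are the positive ones). -/
abbrev EdgeLength (V : Type) [Quiver.{0} V] := ∀ v w : V, (v ⟶ w) → ℝ

namespace QuiverRep

variable {V : Type} [Quiver.{0} V] (R : QuiverRep V) (ρ : EdgeLength V)

/-- The unitary `L_e : H_{s(e)} → H_{t(e)}`. -/
def link {v w : V} (e : v ⟶ w) : (R.obj v).H ≃ₗᵢ[ℂ] (R.obj w).H :=
  PrespectralTriple.Hom.trans (R.map e)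

/-- The weight `b_e = L_e / ρ(e)`. -/
def weight {v w : V} (e : v ⟶ w) : (R.obj v).H →ₗ[ℂ] (R.obj w).H :=
  ((ρ v w e : ℂ)⁻¹) • (R.link e).toLinearEquiv.toLinearMap

/-- The block `H_w → H_v` of the symmetrised weight matrix: the sum of `b_e` over the edges
`e : w → v` and of `b_e*` over the edges `e : v → w`. -/
def diracBlock [∀ v w : V, Fintype (v ⟶ w)] (v w : V) : (R.obj w).H →ₗ[ℂ] (R.obj v).H :=
  (∑ e : w ⟶ v, R.weight ρ e) + ∑ e : v ⟶ w, LinearMap.adjoint (R.weight ρ e)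

/-- The Dirac operator `D_Q(L, ρ)` on `⨁_v H_v` (a finite direct sum, hence the product). -/
def dirac [Fintype V] [∀ v w : V, Fintype (v ⟶ w)] : Module.End ℂ (∀ v, (R.obj v).H) :=
  LinearMap.pi fun v => ∑ w, (R.diracBlock ρ v w).comp (LinearMap.proj w)

end QuiverRep

/-- The spectral action `Tr f(D/Λ)` for a real polynomial `f`. -/
def spectralAction {E : Type} [AddCommGroup E] [Module ℂ E] (f : Polynomial ℝ)
    (D : Module.End ℂ E) (Λ : ℝ) : ℂ :=
  LinearMap.trace ℂ E (Polynomial.aeval ((Λ : ℂ)⁻¹ • D) (f.map (algebraMap ℝ ℂ)))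

/-! ## The lattice quivers -/

/-- The vertices `(ℤ/mℤ)^d` of the torus lattice. -/
def TorusLattice (d m : ℕ) : Type := Fin d → ZMod m

namespace TorusLattice

variable {d m : ℕ}

instance : DecidableEq (TorusLattice d m) := inferInstanceAs (DecidableEq (Fin d → ZMod m))

instance [NeZero m] : Fintype (TorusLattice d m) := inferInstanceAs (Fintype (Fin d → ZMod m))

/-- The neighbour `v + 𝐞_j`. -/
def shift (v : TorusLattice d m) (j : Fin d) : TorusLattice d m :=
  fun k => v k + if k = j then 1 else 0

/-- The quiver `T^d_m`: one edge from `v` to `v + 𝐞_j` for each vertex `v` and each direction `j`. -/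
instance : Quiver.{0} (TorusLattice d m) where
  Hom v w := {j : Fin d // v.shift j = w}

instance (v w : TorusLattice d m) : Fintype (v ⟶ w) :=
  inferInstanceAs (Fintype {j : Fin d // v.shift j = w})

/-- The edge `(v, v + 𝐞_j)`. -/
def edge (v : TorusLattice d m) (j : Fin d) : v ⟶ v.shift j := ⟨j, rfl⟩

/-- The point of the torus `ℝ^d / (a m ℤ)^d` at which the vertex `v` sits when the lattice spacing
is `a`. -/
def point (a : ℝ) (v : TorusLattice d m) : Fin d → ℝ := fun k => a * ((v k).val : ℝ)

end TorusLattice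

/-- The quiver `Q°`, obtained from a quiver `Q` by adding one self-loop `o_v` at each vertex.
It has the vertices of `Q`. -/
def WithLoops (V : Type) : Type := V

namespace WithLoops

variable {V : Type}

/-- A vertex of `Q`, seen as a vertex of `Q°`. -/
def of (v : V) : WithLoops V := v

/-- A vertex of `Q°`, seen as a vertex of `Q`. -/
def base (v : WithLoops V) : V := v

instance [DecidableEq V] : DecidableEq (WithLoops V) := inferInstanceAs (DecidableEq V)

instance [Fintype V] : Fintype (WithLoops V) := inferInstanceAs (Fintype V)

instance [Quiver.{0} V] : Quiver.{0} (WithLoops V) where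
  Hom v w := (v.base ⟶ w.base) ⊕ PLift (v = w)

instance [DecidableEq V] [Quiver.{0} V] [∀ v w : V, Fintype (v ⟶ w)] (v w : WithLoops V) :
    Fintype (v ⟶ w) :=
  inferInstanceAs (Fintype ((v.base ⟶ w.base) ⊕ PLift (v = w)))

/-- An edge of `Q`, seen as an edge of `Q°`. -/
def old [Quiver.{0} V] {v w : V} (e : v ⟶ w) : of v ⟶ of w := Sum.inl e

/-- The self-loop `o_v`. -/
def loop [Quiver.{0} V] (v : WithLoops V) : v ⟶ v := Sum.inr ⟨rfl⟩

end WithLoops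

/-- The quiver `O^d_m`: the torus lattice `T^d_m` with a self-loop at each vertex. -/
abbrev LoopedTorus (d m : ℕ) : Type := WithLoops (TorusLattice d m)

/-- The operator `φ_v = (L_{o_v} + L_{o_v}*) / ρ(o_v)` on `H_v`. -/
def QuiverRep.higgs {V : Type} [Quiver.{0} V] (R : QuiverRep (WithLoops V))
    (ρ : EdgeLength (WithLoops V)) (v : WithLoops V) : Module.End ℂ (R.obj v).H :=
  R.weight ρ (WithLoops.loop v) + LinearMap.adjoint (R.weight ρ (WithLoops.loop v))

/-! ## Matrix fields on the flat torus -/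

/-- `N × N`-matrix-valued functions on `ℝ^d`. -/
abbrev MatrixField (d N : ℕ) : Type := (Fin d → ℝ) → Matrix (Fin N) (Fin N) ℂ

/-- `h` is a smooth hermitian matrix field on the torus `ℝ^d / (ℓ ℤ)^d`. -/
structure IsTorusField {d N : ℕ} (ℓ : ℝ) (h : MatrixField d N) : Prop where
  smooth : ∀ p q, ContDiff ℝ ∞ fun x => h x p q
  periodic : ∀ x j, h (x + Pi.single j ℓ) = h x
  hermitian : ∀ x, (h x).IsHermitian

namespace MatrixField

variable {d N : ℕ}

/-- The partial derivative `∂_j h`, taken entrywise. -/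
def partialDeriv (j : Fin d) (h : MatrixField d N) : MatrixField d N := fun x =>
  Matrix.of fun p q => fderiv ℝ (fun y => h y p q) x (Pi.single j 1)

/-- The covariant derivative `D_j h = ∂_j h + [i A_j, h]`. -/
def covDeriv (A : Fin d → MatrixField d N) (j : Fin d) (h : MatrixField d N) : MatrixField d N :=
  fun x => partialDeriv j h x + Complex.I • (A j x * h x - h x * A j x)

/-- The field strength `F_ij = ∂_i A_j - ∂_j A_i + i [A_i, A_j]`. -/
def curvature (A : Fin d → MatrixField d N) (i j : Fin d) : MatrixField d N :=
  fun x => partialDeriv i (A j) x - partialDeriv j (A i) x +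
    Complex.I • (A i x * A j x - A j x * A i x)

/-- `∫_{𝕋^d} Tr_N (g) d^dx` over the torus of side `ℓ`, i.e. over its fundamental cube. -/
def integralTrace (ℓ : ℝ) (g : MatrixField d N) : ℂ :=
  ∫ x in Set.Icc (0 : Fin d → ℝ) (fun _ => ℓ), (g x).trace

end MatrixField

/-- The representation `R` of `O^d_m`, with lattice spacing `a`, carries the lattice gauge field and
the lattice Higgs field sampled from `A` and `h`, in orthonormal frames `u_v : H_v ≅ ℂ^N`.

`gauge` says that `exp (i a A_j(v))` is the matrix which the edge `(v, v + 𝐞_j)` contributes to the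
row `v` and the column `v + 𝐞_j` of `a D`. As an operator this block goes from the space at
`v + 𝐞_j` to the space at `v`, so it is `L_e* = L_e⁻¹`; with it, `exp (i a A_j(v)) h(v + 𝐞_j)
exp (- i a A_j(v))` is an operator at `v` and loops are traced in the order
`exp (i a A_i(v)) exp (i a A_j(v + 𝐞_i)) ⋯`. -/
structure IsLatticeSample {d m N : ℕ} (a : ℝ) (A : Fin d → MatrixField d N) (h : MatrixField d N)
    (R : QuiverRep (LoopedTorus d m)) (ρ : EdgeLength (LoopedTorus d m))
    (u : ∀ v, (R.obj v).H ≃ₗᵢ[ℂ] EuclideanSpace ℂ (Fin N)) : Prop where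
  /-- Edges of the lattice have length `a`. -/
  spacing : ∀ (v w : TorusLattice d m) (e : v ⟶ w), ρ _ _ (WithLoops.old e) = a
  /-- The self-loops have an arbitrary positive length. -/
  loop_pos : ∀ v : LoopedTorus d m, 0 < ρ v v (WithLoops.loop v)
  gauge : ∀ (v : TorusLattice d m) (j : Fin d) (ψ : EuclideanSpace ℂ (Fin N)),
    u (.of v) ((R.link (WithLoops.old (v.edge j))).symm ((u (.of (v.shift j))).symm ψ)) =
      Matrix.toEuclideanLin (NormedSpace.exp ((Complex.I * a) • A j (v.point a))) ψ
  higgs : ∀ (v : TorusLattice d m) (ψ : EuclideanSpace ℂ (Fin N)),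
    u (.of v) (R.higgs ρ (.of v) ((u (.of v)).symm ψ)) = Matrix.toEuclideanLin (h (v.point a)) ψ

end

/-!
# The smooth limit of the spectral action on a lattice

In unitary frames, `aD` is the sum of the unitary hopping operators `T_j`, their adjoints and the
block-diagonal Higgs operator `φ`. A word of at most four of these operators is too short to wind
around the torus once `m ≥ 5`, so its trace vanishes unless its hops cancel already in `ℤ^d`. The
surviving words reduce to powers of `φ`, up to `Tr [T_i, T_j] [T_i, T_j]*` and
`Tr [T_j, φ] [T_j, φ]*`, which measure how far the hops are from commuting with one another and with
`φ`. This turns `Tr f (aD)` into an exact finite sum over the lattice.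

To leading order in `a` and uniformly on the torus, the commutator of two hops is the defect
`i a ^ 2 F_ij` of a plaquette, and that of a hop with `φ` is `a ^ 2 D_j h`. Finally, the Riemann
sums of a smooth periodic function are accurate to every order in `a`, because its sum over the
translates of the lattice is a function of period `a`.
-/

/-! ## Periodic functions on `ℝ^ι` -/

section PeriodicFunctions

variable {ι E : Type*} {ℓ : ℝ}

theorem periodic_of_mem_span_single [DecidableEq ι] {G : (ι → ℝ) → E}
    (hG : ∀ j, Function.Periodic G (Pi.single j ℓ)) {y : ι → ℝ}
    (hy : y ∈ Submodule.span ℤ (Set.range fun j => (Pi.single j ℓ : ι → ℝ))) :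
    Function.Periodic G y := by
  induction hy using Submodule.span_induction with
  | mem y hy => obtain ⟨j, rfl⟩ := hy; exact hG j
  | zero => exact fun x => by rw [add_zero]
  | add y z _ _ hy hz => exact hy.add_period hz
  | smul n y _ hy => exact hy.zsmul n

variable [Finite ι]

/-- The basis `ℓ e_j` of the period lattice of the torus `ℝ^ι / (ℓ ℤ)^ι`. -/
noncomputable def torusBasis (ι : Type*) [Finite ι] (hℓ : 0 < ℓ) : Module.Basis ι ℝ (ι → ℝ) :=
  (Pi.basisFun ℝ ι).isUnitSMul fun _ => hℓ.ne'.isUnit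

theorem torusBasis_apply [DecidableEq ι] (hℓ : 0 < ℓ) (j : ι) :
    torusBasis ι hℓ j = Pi.single j ℓ := by
  rw [torusBasis, Module.Basis.isUnitSMul_apply, Pi.basisFun_apply, ← Pi.single_smul, smul_eq_mul,
    mul_one]

theorem periodic_of_mem_span_torusBasis [DecidableEq ι] {G : (ι → ℝ) → E} (hℓ : 0 < ℓ)
    (hG : ∀ j, Function.Periodic G (Pi.single j ℓ)) {y : ι → ℝ}
    (hy : y ∈ Submodule.span ℤ (Set.range (torusBasis ι hℓ))) : Function.Periodic G y :=
  periodic_of_mem_span_single hG (by rwa [funext (torusBasis_apply hℓ)] at hy)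

variable [DecidableEq ι] [NormedAddCommGroup E]

theorem exists_norm_le_of_periodic {G : (ι → ℝ) → E} (hℓ : 0 < ℓ) (hc : Continuous G)
    (hG : ∀ j, Function.Periodic G (Pi.single j ℓ)) : ∃ K, ∀ x, ‖G x‖ ≤ K := by
  have := Fintype.ofFinite ι
  obtain ⟨K, hK⟩ := (ZSpan.fundamentalDomain_isBounded
    (torusBasis ι hℓ)).isCompact_closure.exists_bound_of_continuousOn hc.continuousOn
  refine ⟨K, fun x => ?_⟩
  have hx := periodic_of_mem_span_torusBasis hℓ hG (ZSpan.floor (torusBasis ι hℓ) x).2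
  rw [← sub_add_cancel x (ZSpan.floor (torusBasis ι hℓ) x : ι → ℝ), hx]
  exact hK _ (subset_closure (ZSpan.fract_mem_fundamentalDomain _ x))

end PeriodicFunctions

section PeriodicIntegral

open MeasureTheory
open scoped Pointwise

variable {ι E : Type*} [Fintype ι] {ℓ : ℝ}

theorem fundamentalDomain_torusBasis (hℓ : 0 < ℓ) :
    ZSpan.fundamentalDomain (torusBasis ι hℓ) = Set.univ.pi fun _ => Set.Ico 0 ℓ := by
  ext x
  have hrepr : ∀ j, (torusBasis ι hℓ).repr x j = ℓ⁻¹ * x j := fun j => by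
    rw [torusBasis, Module.Basis.repr_isUnitSMul, Pi.basisFun_repr, Units.smul_def,
      Units.val_inv_eq_inv_val, IsUnit.unit_spec, smul_eq_mul]
  simp only [ZSpan.mem_fundamentalDomain, hrepr, Set.mem_univ_pi, Set.mem_Ico,
    inv_mul_lt_one₀ hℓ, inv_pos.2 hℓ, mul_nonneg_iff_of_pos_left]

variable [DecidableEq ι] [NormedAddCommGroup E]

theorem setIntegral_Icc_add_of_periodic [NormedSpace ℝ E] {G : (ι → ℝ) → E} (hℓ : 0 < ℓ)
    (hG : ∀ j, Function.Periodic G (Pi.single j ℓ)) (y : ι → ℝ) :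
    ∫ x in Set.Icc 0 (fun _ => ℓ), G (x + y) = ∫ x in Set.Icc 0 (fun _ => ℓ), G x := by
  have hcube : ZSpan.fundamentalDomain (torusBasis ι hℓ) =ᵐ[volume] Set.Icc 0 (fun _ => ℓ) := by
    rw [fundamentalDomain_torusBasis]
    exact Measure.univ_pi_Ico_ae_eq_Icc
  have : Countable (Submodule.span ℤ (Set.range (torusBasis ι hℓ))).toAddSubgroup :=
    inferInstanceAs (Countable (Submodule.span ℤ (Set.range (torusBasis ι hℓ))))
  have hdom := ZSpan.isAddFundamentalDomain' (torusBasis ι hℓ) volume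
  rw [← setIntegral_congr_set hcube, ← setIntegral_congr_set hcube]
  calc ∫ x in ZSpan.fundamentalDomain (torusBasis ι hℓ), G (x + y)
      = ∫ x in y +ᵥ ZSpan.fundamentalDomain (torusBasis ι hℓ), G x := by
        simp only [← Set.image_vadd, vadd_eq_add, add_comm _ y]
        exact ((measurePreserving_add_left volume y).setIntegral_image_emb
          (measurableEmbedding_addLeft y) G _).symm
    _ = ∫ x in ZSpan.fundamentalDomain (torusBasis ι hℓ), G x :=
        (hdom.vadd_of_comm y).setIntegral_eq hdom fun z x => by
          rw [AddSubgroup.vadd_def, vadd_eq_add, add_comm]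
          exact periodic_of_mem_span_torusBasis hℓ hG z.2 x

theorem norm_sub_le_card_mul_of_norm_update_sub_le {G : (ι → ℝ) → E} {ε : ℝ}
    (h : ∀ x j t, ‖G (Function.update x j t) - G x‖ ≤ ε) (x y : ι → ℝ) :
    ‖G x - G y‖ ≤ Fintype.card ι * ε := by
  have hpiece : ∀ s : Finset ι, ‖G (s.piecewise x y) - G y‖ ≤ s.card * ε := fun s => by
    induction s using Finset.induction with
    | empty => simp
    | insert j s hj ih =>
      rw [Finset.piecewise_insert, Finset.card_insert_of_notMem hj, Nat.cast_succ]
      exact (norm_sub_le_norm_sub_add_norm_sub _ (G (s.piecewise x y)) _).trans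
        ((add_le_add (h _ j _) ih).trans_eq (by ring))
  simpa using hpiece Finset.univ

end PeriodicIntegral

/-! ## Oscillation of periodic functions -/

section Oscillation

variable {E : Type*} [NormedAddCommGroup E] [NormedSpace ℝ E] {g : ℝ → E} {a K : ℝ}

theorem norm_sub_le_of_periodic (ha : 0 < a) (hg : Differentiable ℝ g)
    (hper : Function.Periodic g a) (hK : ∀ t, ‖deriv g t‖ ≤ K) (s t : ℝ) :
    ‖g s - g t‖ ≤ K * a := by
  obtain ⟨y, hy, hgy⟩ := hper.exists_mem_Ico ha s t
  have hK₀ : 0 ≤ K := (norm_nonneg _).trans (hK 0)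
  calc ‖g s - g t‖ = ‖g y - g t‖ := by rw [hgy]
    _ ≤ K * ‖y - t‖ := convex_univ.norm_image_sub_le_of_norm_deriv_le (fun x _ => hg x)
        (fun x _ => hK x) (Set.mem_univ t) (Set.mem_univ y)
    _ ≤ K * a := by
        rw [Real.norm_of_nonneg (sub_nonneg.2 hy.1)]
        exact mul_le_mul_of_nonneg_left (by linarith [hy.2]) hK₀

-- The derivative of a periodic function has mean zero over a period.
theorem norm_deriv_le_of_periodic (ha : 0 < a) (hg : Differentiable ℝ g)
    (hper : Function.Periodic g a) (hosc : ∀ s t, ‖deriv g s - deriv g t‖ ≤ K) (s : ℝ) :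
    ‖deriv g s‖ ≤ K := by
  have hderiv : ∀ t, HasDerivAt (fun t => g t - t • deriv g s) (deriv g t - deriv g s) t :=
    fun t => by simpa using (hg t).hasDerivAt.fun_sub ((hasDerivAt_id t).smul_const (deriv g s))
  have hmean := convex_univ.norm_image_sub_le_of_norm_hasDerivWithin_le
    (fun t _ => (hderiv t).hasDerivWithinAt) (fun t _ => hosc t s) (Set.mem_univ 0)
    (Set.mem_univ a)
  have hg₀ : g a = g 0 := by simpa using hper 0
  rw [hg₀, zero_smul, sub_zero, sub_sub_cancel_left, norm_neg, norm_smul, sub_zero,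
    Real.norm_of_nonneg ha.le, mul_comm K] at hmean
  exact le_of_mul_le_mul_left hmean ha

theorem norm_sub_le_of_periodic_of_norm_iteratedDeriv_le (ha : 0 < a) (n : ℕ)
    (hg : ContDiff ℝ (n + 1) g) (hper : Function.Periodic g a)
    (hK : ∀ t, ‖iteratedDeriv (n + 1) g t‖ ≤ K) (s t : ℝ) : ‖g s - g t‖ ≤ K * a ^ (n + 1) := by
  have hd : Differentiable ℝ g := hg.differentiable (by simp)
  induction n generalizing g s t with
  | zero => simpa using norm_sub_le_of_periodic ha hd hper (by simpa using hK) s t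
  | succ n ih =>
    have hg' : ContDiff ℝ (n + 1) (deriv g) := by
      exact_mod_cast (contDiff_succ_iff_deriv.1 hg).2.2
    have hper' : Function.Periodic (deriv g) a := fun x => by
      rw [← deriv_comp_add_const, funext hper]
    have hosc := ih hg' hper' (by simpa only [← iteratedDeriv_succ'] using hK)
      (hd := hg'.differentiable (by simp))
    rw [pow_succ, ← mul_assoc]
    exact norm_sub_le_of_periodic ha hd hper (norm_deriv_le_of_periodic ha hd hper hosc) s t

theorem norm_sub_sub_smul_deriv_le (ha : 0 ≤ a) {g' g'' : ℝ → E}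
    (hg : ∀ t, HasDerivAt g (g' t) t) (hg' : ∀ t, HasDerivAt g' (g'' t) t)
    (hK : ∀ t, ‖g'' t‖ ≤ K) : ‖g a - g 0 - a • g' 0‖ ≤ K * a ^ 2 := by
  have hosc : ∀ t ∈ Set.Icc 0 a, ‖g' t - g' 0‖ ≤ K * a := fun t ht => by
    have hmean := convex_univ.norm_image_sub_le_of_norm_hasDerivWithin_le
      (fun s _ => (hg' s).hasDerivWithinAt) (fun s _ => hK s) (Set.mem_univ 0) (Set.mem_univ t)
    rw [sub_zero, Real.norm_of_nonneg ht.1] at hmean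
    exact hmean.trans (mul_le_mul_of_nonneg_left ht.2 ((norm_nonneg _).trans (hK 0)))
  have hderiv : ∀ t, HasDerivAt (fun t => g t - t • g' 0) (g' t - g' 0) t := fun t => by
    simpa using (hg t).fun_sub ((hasDerivAt_id t).smul_const (g' 0))
  have hmean := (convex_Icc 0 a).norm_image_sub_le_of_norm_hasDerivWithin_le
    (fun t _ => (hderiv t).hasDerivWithinAt) hosc (Set.left_mem_Icc.2 ha) (Set.right_mem_Icc.2 ha)
  rw [zero_smul, sub_zero, sub_right_comm, sub_zero, Real.norm_of_nonneg ha] at hmean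
  exact hmean.trans_eq (by ring)

end Oscillation

/-! ## Smooth functions on the torus -/

section SmoothPeriodic

variable {ι E F : Type*} [DecidableEq ι] [NormedAddCommGroup E] [NormedSpace ℝ E]
  [NormedAddCommGroup F] [NormedSpace ℝ F] {ℓ : ℝ}

/-- The partial derivative `∂_j G` of a vector-valued function. -/
noncomputable def coordDeriv (j : ι) (G : (ι → ℝ) → E) (x : ι → ℝ) : E :=
  fderiv ℝ G x (Pi.single j 1)

theorem coordDeriv_star [Finite ι] [StarAddMonoid E] [StarModule ℝ E] [ContinuousStar E]
    (j : ι) (G : (ι → ℝ) → E) (x : ι → ℝ) :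
    coordDeriv j (fun y => star (G y)) x = star (coordDeriv j G x) := by
  have := Fintype.ofFinite ι
  rw [coordDeriv, fderiv_star]
  rfl

variable [Fintype ι]

/-- Smooth `E`-valued functions on the torus `ℝ^ι / (ℓ ℤ)^ι`, as periodic functions on `ℝ^ι`. -/
structure IsSmoothPeriodic (ℓ : ℝ) (G : (ι → ℝ) → E) : Prop where
  smooth : ContDiff ℝ ∞ G
  periodic : ∀ j, Function.Periodic G (Pi.single j ℓ)

namespace IsSmoothPeriodic

variable {G H : (ι → ℝ) → E}

theorem differentiable (hG : IsSmoothPeriodic ℓ G) : Differentiable ℝ G :=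
  hG.smooth.differentiable (by simp)

theorem sub (hG : IsSmoothPeriodic ℓ G) (hH : IsSmoothPeriodic ℓ H) :
    IsSmoothPeriodic ℓ fun x => G x - H x :=
  ⟨hG.smooth.sub hH.smooth, fun j x => by simp only [hG.periodic j x, hH.periodic j x]⟩

theorem add (hG : IsSmoothPeriodic ℓ G) (hH : IsSmoothPeriodic ℓ H) :
    IsSmoothPeriodic ℓ fun x => G x + H x :=
  ⟨hG.smooth.add hH.smooth, fun j x => by simp only [hG.periodic j x, hH.periodic j x]⟩

theorem sum {κ : Type*} {s : Finset κ} {G : κ → (ι → ℝ) → E}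
    (hG : ∀ k ∈ s, IsSmoothPeriodic ℓ (G k)) : IsSmoothPeriodic ℓ fun x => ∑ k ∈ s, G k x :=
  ⟨ContDiff.sum fun k hk => (hG k hk).smooth,
    fun j x => Finset.sum_congr rfl fun k hk => (hG k hk).periodic j x⟩

theorem const_smul {R : Type*} [Ring R] [Module R E] [SMulCommClass ℝ R E]
    [ContinuousConstSMul R E] (c : R) (hG : IsSmoothPeriodic ℓ G) :
    IsSmoothPeriodic ℓ fun x => c • G x :=
  ⟨hG.smooth.const_smul c, fun j x => by simp only [hG.periodic j x]⟩

theorem coordDeriv_clm_comp (hG : IsSmoothPeriodic ℓ G) (T : E →L[ℝ] F) (j : ι) (x : ι → ℝ) :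
    coordDeriv j (fun y => T (G y)) x = T (coordDeriv j G x) :=
  congrArg (· (Pi.single j 1)) (T.hasFDerivAt.comp x (hG.differentiable x).hasFDerivAt).fderiv

theorem clm_comp (hG : IsSmoothPeriodic ℓ G) (T : E →L[ℝ] F) :
    IsSmoothPeriodic ℓ fun x => T (G x) :=
  ⟨T.contDiff.comp hG.smooth, fun j x => by simp only [hG.periodic j x]⟩

theorem comp_add_const (hG : IsSmoothPeriodic ℓ G) (y : ι → ℝ) :
    IsSmoothPeriodic ℓ fun x => G (x + y) :=
  ⟨hG.smooth.comp (contDiff_id.add contDiff_const), fun j x => by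
    simp only [add_right_comm, hG.periodic j (x + y)]⟩

protected theorem coordDeriv (hG : IsSmoothPeriodic ℓ G) (j : ι) :
    IsSmoothPeriodic ℓ (coordDeriv j G) := by
  refine ⟨(hG.smooth.fderiv_right (m := ∞) (by simp)).clm_apply contDiff_const, fun k x => ?_⟩
  rw [coordDeriv, ← fderiv_comp_add_right (𝕜 := ℝ), funext (hG.periodic k),
    coordDeriv]

theorem iterate_coordDeriv (hG : IsSmoothPeriodic ℓ G) (j : ι) (n : ℕ) :
    IsSmoothPeriodic ℓ ((coordDeriv j)^[n] G) := by
  induction n generalizing G with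
  | zero => exact hG
  | succ _ ih => exact ih (hG.coordDeriv j)

theorem exists_norm_le (hℓ : 0 < ℓ) (hG : IsSmoothPeriodic ℓ G) : ∃ K, ∀ x, ‖G x‖ ≤ K :=
  exists_norm_le_of_periodic hℓ hG.smooth.continuous hG.periodic

protected theorem hasDerivAt_update (hG : IsSmoothPeriodic ℓ G) (j : ι) (x : ι → ℝ) (t : ℝ) :
    HasDerivAt (fun s => G (Function.update x j s))
      (coordDeriv j G (Function.update x j t)) t :=
  (hG.differentiable _).hasFDerivAt.comp_hasDerivAt t (hasDerivAt_update x j t)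

theorem iteratedDeriv_update (hG : IsSmoothPeriodic ℓ G) (j : ι) (x : ι → ℝ) (n : ℕ) :
    iteratedDeriv n (fun s => G (Function.update x j s)) =
      fun s => (coordDeriv j)^[n] G (Function.update x j s) := by
  induction n generalizing G with
  | zero => exact iteratedDeriv_zero
  | succ n ih =>
    rw [iteratedDeriv_succ', funext fun s => (hG.hasDerivAt_update j x s).deriv,
      ih (hG.coordDeriv j)]
    rfl

theorem iterate_coordDeriv_sum_comp_add {κ : Type*} {s : Finset κ} (hG : IsSmoothPeriodic ℓ G)
    (y : κ → ι → ℝ) (j : ι) (n : ℕ) :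
    (coordDeriv j)^[n] (fun x => ∑ k ∈ s, G (x + y k)) =
      fun x => ∑ k ∈ s, (coordDeriv j)^[n] G (x + y k) := by
  induction n generalizing G with
  | zero => rfl
  | succ n ih =>
    have hsum : coordDeriv j (fun x => ∑ k ∈ s, G (x + y k)) =
        fun x => ∑ k ∈ s, coordDeriv j G (x + y k) := funext fun x => by
      rw [coordDeriv,
        fderiv_fun_sum fun k _ => (hG.comp_add_const (y k)).differentiable x]
      simp only [fderiv_comp_add_right, sum_apply, coordDeriv]
    rw [Function.iterate_succ_apply, hsum, ih (hG.coordDeriv j)]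
    rfl

theorem norm_sub_le {a K : ℝ} (ha : 0 < a) (hG : IsSmoothPeriodic a G) (n : ℕ)
    (hK : ∀ j x, ‖(coordDeriv j)^[n + 1] G x‖ ≤ K) (x y : ι → ℝ) :
    ‖G x - G y‖ ≤ Fintype.card ι * (K * a ^ (n + 1)) := by
  refine norm_sub_le_card_mul_of_norm_update_sub_le (fun x j t => ?_) x y
  have hupdate := norm_sub_le_of_periodic_of_norm_iteratedDeriv_le (K := K) ha n
    (g := fun s => G (Function.update x j s))
    ((hG.smooth.of_le (by exact_mod_cast le_top)).comp (contDiff_update _ x j))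
    (fun s => ?_) (fun s => ?_) t (x j)
  · simpa only [Function.update_eq_self] using hupdate
  · have := hG.periodic j (Function.update x j s)
    rwa [Pi.single, ← Function.update_add, add_zero] at this
  · rw [hG.iteratedDeriv_update]
    exact hK j _

theorem exists_norm_add_single_sub_le (hℓ : 0 < ℓ) (hG : IsSmoothPeriodic ℓ G) (j : ι) :
    ∃ K, ∀ (x : ι → ℝ) (a : ℝ), 0 ≤ a →
      ‖G (x + Pi.single j a) - G x - a • coordDeriv j G x‖ ≤ K * a ^ 2 := by
  obtain ⟨K, hK⟩ := ((hG.coordDeriv j).coordDeriv j).exists_norm_le hℓ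
  refine ⟨K, fun x a ha => ?_⟩
  have hline : ∀ {G' : (ι → ℝ) → E}, IsSmoothPeriodic ℓ G' → ∀ t, HasDerivAt
      (fun t => G' (x + Pi.single j t)) (coordDeriv j G' (x + Pi.single j t)) t :=
    fun hG' t => (hG'.differentiable _).hasFDerivAt.comp_hasDerivAt t
      ((hasDerivAt_single j t).const_add x)
  simpa using norm_sub_sub_smul_deriv_le ha (hline hG) (hline (hG.coordDeriv j)) fun t => hK _

section Algebra

variable {𝔸 : Type*} [NormedRing 𝔸] [NormedAlgebra ℝ 𝔸] {G H : (ι → ℝ) → 𝔸}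

theorem mul (hG : IsSmoothPeriodic ℓ G) (hH : IsSmoothPeriodic ℓ H) :
    IsSmoothPeriodic ℓ fun x => G x * H x :=
  ⟨hG.smooth.mul hH.smooth, fun j x => by simp only [hG.periodic j x, hH.periodic j x]⟩

theorem pow (hG : IsSmoothPeriodic ℓ G) (n : ℕ) : IsSmoothPeriodic ℓ fun x => G x ^ n :=
  ⟨hG.smooth.pow n, fun j x => by simp only [hG.periodic j x]⟩

end Algebra

end IsSmoothPeriodic

end SmoothPeriodic

/-! ## Riemann sums -/

section RiemannSum

variable {ι E : Type*} {m : ℕ} [NeZero m] {a ℓ : ℝ}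

/-- The point of `ℝ^ι` at which the lattice site `v` sits when the lattice spacing is `a`. -/
def latticePoint (a : ℝ) (v : ι → ZMod m) : ι → ℝ := fun k => a * ((v k).val : ℝ)

open MeasureTheory in
theorem volume_real_Icc_zero_const [Fintype ι] (hℓ : 0 ≤ ℓ) :
    volume.real (Set.Icc (0 : ι → ℝ) fun _ => ℓ) = ℓ ^ Fintype.card ι := by
  rw [measureReal_def, Real.volume_Icc_pi_toReal (a := 0) fun _ => hℓ]
  simp

variable [DecidableEq ι]

theorem periodic_latticePoint_add_single (ham : a * m = ℓ) {G : (ι → ℝ) → E}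
    (hG : ∀ j, Function.Periodic G (Pi.single j ℓ)) (v : ι → ZMod m) (j : ι) (x : ι → ℝ) :
    G (x + latticePoint a (v + Pi.single j 1)) = G (x + latticePoint a v + Pi.single j a) := by
  have hwrap : ((v j + 1).val + m * (((v j).val + 1) / m) : ℕ) = (v j).val + 1 := by
    rw [ZMod.val_add, ZMod.val_one_eq_one_mod, Nat.add_mod_mod, Nat.mod_add_div]
  have hpoint : latticePoint a v + Pi.single j a = latticePoint a (v + Pi.single j 1) +
      (((v j).val + 1) / m) • Pi.single j ℓ := by
    funext k
    rcases eq_or_ne k j with rfl | hk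
    · have := congrArg (Nat.cast (R := ℝ)) hwrap
      push_cast at this
      rw [Pi.add_apply, Pi.add_apply, Pi.smul_apply, Pi.single_eq_same, Pi.single_eq_same,
        nsmul_eq_mul, ← ham]
      simp only [latticePoint, Pi.add_apply, Pi.single_eq_same]
      linear_combination -a * this
    · simp [latticePoint, hk]
  rw [add_assoc, hpoint, ← add_assoc]
  exact ((hG j).nsmul _ _).symm

variable [Fintype ι] [NormedAddCommGroup E]

theorem periodic_sum_comp_add_latticePoint (ham : a * m = ℓ) {G : (ι → ℝ) → E}
    (hG : ∀ j, Function.Periodic G (Pi.single j ℓ)) (j : ι) :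
    Function.Periodic (fun x => ∑ v : ι → ZMod m, G (x + latticePoint a v)) (Pi.single j a) := by
  intro x
  calc ∑ v : ι → ZMod m, G (x + Pi.single j a + latticePoint a v)
      = ∑ v, G (x + latticePoint a (v + Pi.single j 1)) := by
        simp only [periodic_latticePoint_add_single ham hG, add_right_comm x]
    _ = ∑ v : ι → ZMod m, G (x + latticePoint a v) :=
        Fintype.sum_equiv (Equiv.addRight (Pi.single j 1)) _ _ fun _ => rfl

open MeasureTheory

variable [NormedSpace ℝ E]

theorem setIntegral_sum_comp_add_latticePoint (hℓ : 0 < ℓ) {G : (ι → ℝ) → E}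
    (hc : Continuous G) (hG : ∀ j, Function.Periodic G (Pi.single j ℓ)) :
    ∫ x in Set.Icc 0 (fun _ => ℓ), ∑ v : ι → ZMod m, G (x + latticePoint a v) =
      m ^ Fintype.card ι • ∫ x in Set.Icc 0 (fun _ => ℓ), G x := by
  have hint : ∀ v : ι → ZMod m,
      IntegrableOn (fun x => G (x + latticePoint a v)) (Set.Icc 0 fun _ => ℓ) := fun v =>
    (hc.comp (continuous_id.add continuous_const)).continuousOn.integrableOn_compact isCompact_Icc
  rw [integral_finsetSum _ fun v _ => hint v]
  simp only [setIntegral_Icc_add_of_periodic hℓ hG, Finset.sum_const, Finset.card_univ,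
    Fintype.card_fun, ZMod.card]

theorem smul_sum_latticePoint_sub_setIntegral [CompleteSpace E] (hℓ : 0 < ℓ) (ham : a * m = ℓ)
    {G : (ι → ℝ) → E} (hc : Continuous G) (hG : ∀ j, Function.Periodic G (Pi.single j ℓ)) :
    (m : ℝ) ^ Fintype.card ι • (a ^ Fintype.card ι • ∑ v : ι → ZMod m, G (latticePoint a v) -
        ∫ x in Set.Icc 0 (fun _ => ℓ), G x) =
      ∫ x in Set.Icc 0 (fun _ => ℓ), (∑ v : ι → ZMod m, G (latticePoint a v) -
        ∑ v : ι → ZMod m, G (x + latticePoint a v)) := by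
  have hsum : Continuous fun x => ∑ v : ι → ZMod m, G (x + latticePoint a v) :=
    continuous_finsetSum _ fun _ _ => hc.comp (continuous_id.add continuous_const)
  have hconst : IntegrableOn (fun _ : ι → ℝ => ∑ v : ι → ZMod m, G (latticePoint a v))
      (Set.Icc 0 fun _ => ℓ) := continuousOn_const.integrableOn_compact isCompact_Icc
  rw [integral_sub hconst (hsum.continuousOn.integrableOn_compact isCompact_Icc),
    setIntegral_const, volume_real_Icc_zero_const hℓ.le,
    setIntegral_sum_comp_add_latticePoint hℓ hc hG, smul_sub, smul_smul, ← mul_pow,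
    mul_comm (m : ℝ), ham, ← Nat.cast_pow, Nat.cast_smul_eq_nsmul]

namespace IsSmoothPeriodic

theorem sum_comp_add_latticePoint {G : (ι → ℝ) → E} (hG : IsSmoothPeriodic ℓ G)
    (ham : a * m = ℓ) :
    IsSmoothPeriodic a fun x => ∑ v : ι → ZMod m, G (x + latticePoint a v) :=
  ⟨ContDiff.sum fun _ _ => (hG.comp_add_const _).smooth,
    periodic_sum_comp_add_latticePoint ham hG.periodic⟩

-- Summing `G` over the lattice translates of a point gives a function `S` of period `a`, which is
-- constant up to `O(a ^ (n + 1))`, and whose mean over the torus is that of `G`.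
theorem exists_norm_sum_latticePoint_sub_setIntegral_le [CompleteSpace E] {G : (ι → ℝ) → E}
    (hℓ : 0 < ℓ) (hG : IsSmoothPeriodic ℓ G) (n : ℕ) :
    ∃ C, ∀ (m : ℕ) [NeZero m] (a : ℝ), a * m = ℓ →
      ‖a ^ Fintype.card ι • ∑ v : ι → ZMod m, G (latticePoint a v) -
        ∫ x in Set.Icc 0 (fun _ => ℓ), G x‖ ≤ C * a ^ (n + 1) := by
  choose K hK using fun j => (hG.iterate_coordDeriv j (n + 1)).exists_norm_le hℓ
  have hK₀ : ∀ j, 0 ≤ K j := fun j => (norm_nonneg _).trans (hK j 0)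
  refine ⟨ℓ ^ Fintype.card ι * (Fintype.card ι * ∑ j, K j), fun m _ a ham => ?_⟩
  set S : (ι → ℝ) → E := fun x => ∑ v : ι → ZMod m, G (x + latticePoint a v)
  have hm : (0 : ℝ) < m := Nat.cast_pos.2 (NeZero.pos m)
  have ha : 0 < a := pos_of_mul_pos_left (ham ▸ hℓ) hm.le
  have hosc : ∀ x, ‖S 0 - S x‖ ≤
      Fintype.card ι * ((m ^ Fintype.card ι * ∑ j, K j) * a ^ (n + 1)) :=
    (hG.sum_comp_add_latticePoint ham).norm_sub_le ha n (fun j x => by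
      rw [hG.iterate_coordDeriv_sum_comp_add]
      refine (norm_sum_le_of_le _ fun v _ => hK j (x + latticePoint a v)).trans ?_
      rw [Finset.sum_const, Finset.card_univ, Fintype.card_fun, ZMod.card, nsmul_eq_mul,
        Nat.cast_pow]
      gcongr
      exact Finset.single_le_sum (fun j _ => hK₀ j) (Finset.mem_univ j)) 0
  simp only [S, zero_add] at hosc
  refine le_of_mul_le_mul_left ?_ (pow_pos hm (Fintype.card ι))
  rw [← Real.norm_natCast, ← norm_pow, ← norm_smul,
    smul_sum_latticePoint_sub_setIntegral hℓ ham hG.smooth.continuous hG.periodic]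
  refine (norm_setIntegral_le_of_norm_le_const isCompact_Icc.measure_lt_top
    fun x _ => hosc x).trans_eq ?_
  rw [volume_real_Icc_zero_const hℓ.le, norm_pow, Real.norm_natCast]
  ring

end IsSmoothPeriodic

end RiemannSum

section ContinuumLimit

open Asymptotics Filter MeasureTheory Topology

variable {ι E : Type*} [Fintype ι] [NormedAddCommGroup E] [NormedSpace ℝ E] {ℓ : ℝ}

/-- The spacing of the lattice with `m` points along each side of the torus of side `ℓ`. -/
noncomputable def latticeSpacing (ℓ : ℝ) (m : ℕ+) : ℝ := ℓ / m

theorem latticeSpacing_mul (ℓ : ℝ) (m : ℕ+) : latticeSpacing ℓ m * (m : ℕ) = ℓ :=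
  div_mul_cancel₀ ℓ (Nat.cast_ne_zero.2 m.ne_zero)

theorem latticeSpacing_pos (hℓ : 0 < ℓ) (m : ℕ+) : 0 < latticeSpacing ℓ m :=
  div_pos hℓ (Nat.cast_pos.2 m.pos)

theorem tendsto_latticeSpacing (hℓ : 0 < ℓ) : Tendsto (latticeSpacing ℓ) atTop (𝓝[>] 0) :=
  tendsto_nhdsWithin_iff.2 ⟨tendsto_const_nhds.div_atTop
    (tendsto_natCast_atTop_atTop.comp tendsto_PNat_val_atTop_atTop),
    Eventually.of_forall (latticeSpacing_pos hℓ)⟩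

variable [DecidableEq ι]

/-- The Riemann sum of `G` over the lattice with `m` points along each side of the torus. -/
noncomputable def riemannSum (ℓ : ℝ) (m : ℕ+) (G : (ι → ℝ) → E) : E :=
  latticeSpacing ℓ m ^ Fintype.card ι • ∑ v : ι → ZMod m, G (latticePoint (latticeSpacing ℓ m) v)

theorem riemannSum_const_smul (ℓ : ℝ) (m : ℕ+) (c : ℝ) (G : (ι → ℝ) → E) :
    riemannSum ℓ m (fun x => c • G x) = c • riemannSum ℓ m G := by
  rw [riemannSum, riemannSum, ← Finset.smul_sum, smul_comm]

theorem riemannSum_sub (ℓ : ℝ) (m : ℕ+) (G H : (ι → ℝ) → E) :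
    riemannSum ℓ m (fun x => G x - H x) = riemannSum ℓ m G - riemannSum ℓ m H := by
  rw [riemannSum, riemannSum, riemannSum, ← smul_sub, ← Finset.sum_sub_distrib]

theorem norm_riemannSum_le (hℓ : 0 < ℓ) (m : ℕ+) {G : (ι → ℝ) → E} {C : ℝ}
    (hG : ∀ x, ‖G x‖ ≤ C) : ‖riemannSum ℓ m G‖ ≤ ℓ ^ Fintype.card ι * C := by
  have ha := latticeSpacing_pos hℓ m
  rw [riemannSum, norm_smul, norm_pow, Real.norm_of_nonneg ha.le]
  refine (mul_le_mul_of_nonneg_left (norm_sum_le_of_le _ fun v _ => hG _)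
    (pow_nonneg ha.le _)).trans_eq ?_
  rw [Finset.sum_const, Finset.card_univ, Fintype.card_fun, ZMod.card, nsmul_eq_mul, Nat.cast_pow,
    ← mul_assoc, ← mul_pow, latticeSpacing_mul]

theorem isBigO_riemannSum (hℓ : 0 < ℓ) {G : ℕ+ → (ι → ℝ) → E} {g : ℕ+ → ℝ}
    (hG : (fun p : ℕ+ × (ι → ℝ) => G p.1 p.2) =O[atTop ×ˢ ⊤] fun p => g p.1) :
    (fun m => riemannSum ℓ m (G m)) =O[atTop] g := by
  obtain ⟨C, hC⟩ := hG.bound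
  refine IsBigO.of_bound (ℓ ^ Fintype.card ι * C) (hC.curry.mono fun m hm => ?_)
  exact (norm_riemannSum_le hℓ m (eventually_top.1 hm)).trans_eq (mul_assoc _ _ _).symm

namespace IsSmoothPeriodic

variable [CompleteSpace E]

theorem riemannSum_sub_setIntegral_isBigO (hℓ : 0 < ℓ) {G : (ι → ℝ) → E}
    (hG : IsSmoothPeriodic ℓ G) (n : ℕ) :
    (fun m => riemannSum ℓ m G - ∫ x in Set.Icc 0 (fun _ => ℓ), G x) =O[atTop]
      fun m => latticeSpacing ℓ m ^ (n + 1) := by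
  obtain ⟨C, hC⟩ := hG.exists_norm_sum_latticePoint_sub_setIntegral_le hℓ n
  refine IsBigO.of_bound C (Eventually.of_forall fun m => ?_)
  rw [norm_pow, Real.norm_of_nonneg (latticeSpacing_pos hℓ m).le]
  exact hC m _ (latticeSpacing_mul ℓ m)

theorem pow_smul_riemannSum_sub_isBigO (hℓ : 0 < ℓ) {G : (ι → ℝ) → E}
    (hG : IsSmoothPeriodic ℓ G) {k n : ℕ} (hkn : k < n) :
    (fun m => latticeSpacing ℓ m ^ k •
      (riemannSum ℓ m G - ∫ x in Set.Icc 0 (fun _ => ℓ), G x)) =O[atTop]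
      fun m => latticeSpacing ℓ m ^ n := by
  obtain ⟨r, rfl⟩ := Nat.exists_eq_add_of_lt hkn
  simp only [add_assoc, pow_add _ k]
  simpa only [smul_eq_mul] using (isBigO_refl (fun m => latticeSpacing ℓ m ^ k) atTop).smul
    (hG.riemannSum_sub_setIntegral_isBigO hℓ r)

theorem riemannSum_sub_pow_smul_isBigO (hℓ : 0 < ℓ) {G : ℕ+ → (ι → ℝ) → E} {g : (ι → ℝ) → E}
    (hg : IsSmoothPeriodic ℓ g) {k : ℕ}
    (hG : (fun p : ℕ+ × (ι → ℝ) => G p.1 p.2 - latticeSpacing ℓ p.1 ^ k • g p.2)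
      =O[atTop ×ˢ ⊤] fun p => latticeSpacing ℓ p.1 ^ (k + 1)) :
    (fun m => riemannSum ℓ m (G m) -
      latticeSpacing ℓ m ^ k • ∫ x in Set.Icc 0 (fun _ => ℓ), g x) =O[atTop]
      fun m => latticeSpacing ℓ m ^ (k + 1) := by
  have hsum := isBigO_riemannSum hℓ (g := fun m => latticeSpacing ℓ m ^ (k + 1))
    (G := fun m x => G m x - latticeSpacing ℓ m ^ k • g x) hG
  refine (hsum.add (hg.pow_smul_riemannSum_sub_isBigO hℓ k.lt_succ_self)).congr_left fun m => ?_
  rw [riemannSum_sub, riemannSum_const_smul, smul_sub, sub_add_sub_cancel]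

end IsSmoothPeriodic

end ContinuumLimit

/-! ## Expansions in the lattice spacing -/

section Expansion

open Asymptotics Filter Topology

variable {𝔸 α : Type*} [NormedRing 𝔸] [NormedAlgebra ℝ 𝔸] {l : Filter α} {a : α → ℝ}

theorem isBigO_exp_sub_quadratic [CompleteSpace 𝔸] {X : α → 𝔸} (ha : Tendsto a l (𝓝 0))
    (hX : X =O[l] a) :
    (fun p => NormedSpace.exp (X p) - (1 + X p + (2 : ℝ)⁻¹ • X p ^ 2)) =O[l] fun p => a p ^ 3 := by
  have hexp := (NormedSpace.exp_hasFPowerSeriesAt_zero (𝕂 := ℝ) (𝔸 := 𝔸)).isBigO_sub_partialSum_pow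
    3 |>.comp_tendsto (hX.trans_tendsto ha)
  refine (hexp.congr_left fun p => ?_).trans (hX.norm_left.pow 3)
  simp [FormalMultilinearSeries.partialSum, Finset.sum_range_succ, NormedSpace.expSeries_apply_eq]

theorem isBigO_pow_of_le (ha : Tendsto a l (𝓝 0)) {k n : ℕ} (hkn : k ≤ n) :
    (fun p => a p ^ n) =O[l] fun p => a p ^ k := by
  rcases hkn.eq_or_lt with rfl | hlt
  · exact isBigO_refl _ l
  · exact (isLittleO_pow_pow hlt).isBigO.comp_tendsto ha

theorem isBigO_pow_smul {E : Type*} [NormedAddCommGroup E] [NormedSpace ℝ E] {X : α → E}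
    (hX : X =O[l] fun _ => (1 : ℝ)) (k : ℕ) : (fun p => a p ^ k • X p) =O[l] fun p => a p ^ k := by
  simpa using (isBigO_refl (fun p => a p ^ k) l).smul hX

theorem isBigO_quadratic {P Q : α → 𝔸} (ha : Tendsto a l (𝓝 0))
    (hP : P =O[l] fun _ => (1 : ℝ)) (hQ : Q =O[l] fun _ => (1 : ℝ)) :
    (fun p => 1 + a p • P p + a p ^ 2 • Q p) =O[l] fun _ => (1 : ℝ) := by
  have hlinear := (isBigO_pow_smul (a := a) hP 1).trans (isBigO_pow_of_le ha zero_le_one)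
  have hquad := (isBigO_pow_smul (a := a) hQ 2).trans (isBigO_pow_of_le ha zero_le_two)
  simp only [pow_one, pow_zero] at hlinear hquad
  exact ((isBigO_const_const 1 one_ne_zero l).add hlinear).add hquad

theorem isBigO_mul_sub_quadratic {X Y P P' Q Q' : α → 𝔸} (ha : Tendsto a l (𝓝 0))
    (hP : P =O[l] fun _ => (1 : ℝ)) (hP' : P' =O[l] fun _ => (1 : ℝ))
    (hQ : Q =O[l] fun _ => (1 : ℝ)) (hQ' : Q' =O[l] fun _ => (1 : ℝ))
    (hX : (fun p => X p - (1 + a p • P p + a p ^ 2 • Q p)) =O[l] fun p => a p ^ 3)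
    (hY : (fun p => Y p - (1 + a p • P' p + a p ^ 2 • Q' p)) =O[l] fun p => a p ^ 3) :
    (fun p => X p * Y p - (1 + a p • (P p + P' p) + a p ^ 2 • (Q p + Q' p + P p * P' p)))
      =O[l] fun p => a p ^ 3 := by
  have hY₁ : Y =O[l] fun _ => (1 : ℝ) := by
    simpa using (hY.trans (isBigO_pow_of_le ha (Nat.zero_le 3))).add (isBigO_quadratic ha hP' hQ')
  have hleft := hX.mul hY₁
  have hright := (isBigO_quadratic ha hP hQ).mul hY
  have hcubic : (fun p => a p ^ 3 • (P p * Q' p + Q p * P' p)) =O[l] fun p => a p ^ 3 :=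
    isBigO_pow_smul (by simpa using (hP.mul hQ').add (hQ.mul hP')) 3
  have hquartic : (fun p => a p ^ 4 • (Q p * Q' p)) =O[l] fun p => a p ^ 3 :=
    (isBigO_pow_smul (by simpa using hQ.mul hQ') 4).trans (isBigO_pow_of_le ha (by lia))
  simp only [mul_one, one_mul] at hleft hright
  refine (((hleft.add hright).add hcubic).add hquartic).congr_left fun p => ?_
  simp only [mul_add, add_mul, sub_mul, mul_sub, one_mul, mul_one, smul_mul_assoc, mul_smul_comm,
    smul_smul, smul_add]
  module

theorem isBigO_mul_star_sub [StarRing 𝔸] [NormedStarGroup 𝔸] [StarModule ℝ 𝔸] {K F : α → 𝔸}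
    {k : ℕ} (ha : Tendsto a l (𝓝 0)) (hF : F =O[l] fun _ => (1 : ℝ))
    (hK : (fun p => K p - a p ^ k • F p) =O[l] fun p => a p ^ (k + 1)) :
    (fun p => K p * star (K p) - a p ^ (2 * k) • (F p * star (F p))) =O[l]
      fun p => a p ^ (2 * k + 1) := by
  have hstar : ∀ {Y : α → 𝔸} {r : ℕ}, (Y =O[l] fun p => a p ^ r) →
      (fun p => star (Y p)) =O[l] fun p => a p ^ r := fun hY =>
    (isBigO_norm_left.1 (by simpa only [norm_star] using hY.norm_left))
  have hmain := isBigO_pow_smul (a := a) hF k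
  have hKk : K =O[l] fun p => a p ^ k := by
    simpa using (hK.trans (isBigO_pow_of_le ha k.le_succ)).add hmain
  have hleft := hK.mul (hstar hKk)
  have hright := hmain.mul (hstar hK)
  simp only [← pow_add, show k + 1 + k = 2 * k + 1 by lia, show k + (k + 1) = 2 * k + 1 by lia]
    at hleft hright
  refine (hleft.add hright).congr_left fun p => ?_
  simp only [star_sub, star_smul, star_trivial, sub_mul, mul_sub, smul_mul_assoc, mul_smul_comm,
    smul_smul, ← pow_add, ← two_mul]
  abel

end Expansion

/-! ## Lattice gauge fields -/

section GaugeField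

open Asymptotics Filter Topology

variable {ι 𝔸 α : Type*} [Fintype ι] [DecidableEq ι] {ℓ : ℝ} {l : Filter α} {a : α → ℝ}

namespace IsSmoothPeriodic

section

variable {E : Type*} [NormedAddCommGroup E] [NormedSpace ℝ E] {G : (ι → ℝ) → E}

theorem isBigO_one (hℓ : 0 < ℓ) (hG : IsSmoothPeriodic ℓ G) (x : α → ι → ℝ) :
    (fun p => G (x p)) =O[l] fun _ => (1 : ℝ) := by
  obtain ⟨K, hK⟩ := hG.exists_norm_le hℓ
  exact IsBigO.of_bound K (Eventually.of_forall fun p => by simpa using hK (x p))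

theorem isBigO_add_single_sub_sub_smul (hℓ : 0 < ℓ) (hG : IsSmoothPeriodic ℓ G)
    (ha : Tendsto a l (𝓝[>] 0)) (j : ι) (x : α → ι → ℝ) :
    (fun p => G (x p + Pi.single j (a p)) - G (x p) - a p • coordDeriv j G (x p))
      =O[l] fun p => a p ^ 2 := by
  obtain ⟨K, hK⟩ := hG.exists_norm_add_single_sub_le hℓ j
  refine IsBigO.of_bound K ?_
  filter_upwards [ha.eventually self_mem_nhdsWithin] with p hp
  simpa using hK (x p) (a p) (Set.mem_Ioi.1 hp).le

theorem isBigO_add_single_sub (hℓ : 0 < ℓ) (hG : IsSmoothPeriodic ℓ G)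
    (ha : Tendsto a l (𝓝[>] 0)) (j : ι) (x : α → ι → ℝ) :
    (fun p => G (x p + Pi.single j (a p)) - G (x p)) =O[l] a := by
  have hquad := (hG.isBigO_add_single_sub_sub_smul hℓ ha j x).trans
    (isBigO_pow_of_le (tendsto_nhds_of_tendsto_nhdsWithin ha) one_le_two)
  have hlinear := isBigO_pow_smul (a := a) ((hG.coordDeriv j).isBigO_one (l := l) hℓ x) 1
  simp only [pow_one] at hquad hlinear
  simpa using hquad.add hlinear

end

end IsSmoothPeriodic

variable [NormedRing 𝔸] [NormedAlgebra ℝ 𝔸]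

/-- The lattice gauge field `exp (a X_j)` of spacing `a` sampled from the connection
`∑ j, X_j dx_j`. Here `X_j` stands for `i A_j` in the physics convention. -/
noncomputable def gaugeLink (X : ι → (ι → ℝ) → 𝔸) (a : ℝ) (j : ι) (x : ι → ℝ) : 𝔸 :=
  NormedSpace.exp (a • X j x)

/-- The difference of the two lattice parallel transports across the plaquette spanned by the
directions `i` and `j` at `x`: the lattice version of the curvature. -/
noncomputable def plaquetteDefect (X : ι → (ι → ℝ) → 𝔸) (a : ℝ) (i j : ι) (x : ι → ℝ) : 𝔸 :=
  gaugeLink X a i x * gaugeLink X a j (x + Pi.single i a) -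
    gaugeLink X a j x * gaugeLink X a i (x + Pi.single j a)

/-- The failure of `h` to be parallel along the link in direction `j` at `x`: the lattice version
of the covariant derivative. -/
noncomputable def higgsDefect (X : ι → (ι → ℝ) → 𝔸) (h : (ι → ℝ) → 𝔸) (a : ℝ) (j : ι)
    (x : ι → ℝ) : 𝔸 :=
  gaugeLink X a j x * h (x + Pi.single j a) - h x * gaugeLink X a j x

variable [CompleteSpace 𝔸] {X : ι → (ι → ℝ) → 𝔸} {h : (ι → ℝ) → 𝔸}

theorem gaugeLink_isBigO_quadratic (hℓ : 0 < ℓ) {j : ι} (hX : IsSmoothPeriodic ℓ (X j))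
    (ha : Tendsto a l (𝓝 0)) (x : α → ι → ℝ) :
    (fun p => gaugeLink X (a p) j (x p) -
        (1 + a p • X j (x p) + a p ^ 2 • ((2 : ℝ)⁻¹ • X j (x p) ^ 2))) =O[l]
      fun p => a p ^ 3 := by
  have hlinear := isBigO_pow_smul (a := a) (hX.isBigO_one (l := l) hℓ x) 1
  simp only [pow_one] at hlinear
  refine (isBigO_exp_sub_quadratic ha hlinear).congr_left fun p => ?_
  rw [gaugeLink, smul_pow, smul_comm]

theorem gaugeLink_isBigO_linear (hℓ : 0 < ℓ) {j : ι} (hX : IsSmoothPeriodic ℓ (X j))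
    (ha : Tendsto a l (𝓝 0)) (x : α → ι → ℝ) :
    (fun p => gaugeLink X (a p) j (x p) - (1 + a p • X j (x p))) =O[l] fun p => a p ^ 2 := by
  have hcubic := (gaugeLink_isBigO_quadratic hℓ hX ha x).trans
    (isBigO_pow_of_le ha (show 2 ≤ 3 by lia))
  have hquad := isBigO_pow_smul (a := a) (((hX.pow 2).const_smul (2 : ℝ)⁻¹).isBigO_one
    (l := l) hℓ x) 2
  exact (hcubic.add hquad).congr_left fun p => by abel

theorem gaugeLink_add_single_isBigO_quadratic (hℓ : 0 < ℓ) {j : ι}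
    (hX : IsSmoothPeriodic ℓ (X j)) (ha : Tendsto a l (𝓝[>] 0)) (i : ι) (x : α → ι → ℝ) :
    (fun p => gaugeLink X (a p) j (x p + Pi.single i (a p)) - (1 + a p • X j (x p) +
        a p ^ 2 • (coordDeriv i (X j) (x p) + (2 : ℝ)⁻¹ • X j (x p) ^ 2))) =O[l]
      fun p => a p ^ 3 := by
  have hlink := gaugeLink_isBigO_quadratic hℓ hX (tendsto_nhds_of_tendsto_nhdsWithin ha)
    fun p => x p + Pi.single i (a p)
  have htaylor := (isBigO_refl a l).smul (hX.isBigO_add_single_sub_sub_smul hℓ ha i x)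
  have hsq := (isBigO_refl (fun p => a p ^ 2) l).smul
    (((hX.pow 2).isBigO_add_single_sub hℓ ha i x).const_smul_left (2 : ℝ)⁻¹)
  simp only [smul_eq_mul, ← pow_succ, ← pow_succ'] at htaylor hsq
  refine ((hlink.add htaylor).add hsq).congr_left fun p => ?_
  simp only [Pi.smul_apply]
  module

theorem plaquetteDefect_isBigO (hℓ : 0 < ℓ) (hX : ∀ j, IsSmoothPeriodic ℓ (X j))
    (ha : Tendsto a l (𝓝[>] 0)) (i j : ι) (x : α → ι → ℝ) :
    (fun p => plaquetteDefect X (a p) i j (x p) - a p ^ 2 • (coordDeriv i (X j) (x p) -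
        coordDeriv j (X i) (x p) + (X i (x p) * X j (x p) - X j (x p) * X i (x p)))) =O[l]
      fun p => a p ^ 3 := by
  have ha₀ := tendsto_nhds_of_tendsto_nhdsWithin ha
  have hhalf := fun j => ((hX j).pow 2).const_smul (2 : ℝ)⁻¹
  have hproduct := fun i j => isBigO_mul_sub_quadratic ha₀ ((hX i).isBigO_one hℓ x)
    ((hX j).isBigO_one hℓ x) ((hhalf i).isBigO_one hℓ x)
    ((((hX j).coordDeriv i).add (hhalf j)).isBigO_one hℓ x)
    (gaugeLink_isBigO_quadratic hℓ (hX i) ha₀ x)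
    (gaugeLink_add_single_isBigO_quadratic hℓ (hX j) ha i x)
  refine ((hproduct i j).sub (hproduct j i)).congr_left fun p => ?_
  rw [plaquetteDefect]
  module

theorem higgsDefect_isBigO (hℓ : 0 < ℓ) {j : ι} (hX : IsSmoothPeriodic ℓ (X j))
    (hh : IsSmoothPeriodic ℓ h) (ha : Tendsto a l (𝓝[>] 0)) (x : α → ι → ℝ) :
    (fun p => higgsDefect X h (a p) j (x p) - a p • (coordDeriv j h (x p) +
        (X j (x p) * h (x p) - h (x p) * X j (x p)))) =O[l] fun p => a p ^ 2 := by
  have hlink := gaugeLink_isBigO_linear hℓ hX (tendsto_nhds_of_tendsto_nhdsWithin ha) x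
  have hshifted := hlink.mul (hh.isBigO_one hℓ fun p => x p + Pi.single j (a p))
  have hbase := (hh.isBigO_one hℓ x).mul hlink
  have htaylor := hh.isBigO_add_single_sub_sub_smul hℓ ha j x
  have hmixed := (isBigO_pow_smul (a := a) (hX.isBigO_one hℓ x) 1).mul
    (hh.isBigO_add_single_sub hℓ ha j x)
  simp only [mul_one, one_mul, ← pow_succ] at hshifted hbase hmixed
  refine (((hshifted.sub hbase).add htaylor).add hmixed).congr_left fun p => ?_
  simp only [higgsDefect, add_mul, sub_mul, mul_sub, mul_add, one_mul, mul_one, smul_mul_assoc,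
    mul_smul_comm, pow_one]
  module

end GaugeField

/-! ## Matrix fields -/

section MatrixField

open Asymptotics Filter Topology
open scoped Matrix Matrix.Norms.Frobenius

variable {d N : ℕ} {ℓ : ℝ} {A : Fin d → MatrixField d N} {h M : MatrixField d N}

theorem contDiff_matrix_of_entries {E n : Type*} [NormedAddCommGroup E] [NormedSpace ℝ E]
    [Fintype n] {G : E → Matrix n n ℂ} {r : WithTop ℕ∞}
    (hG : ∀ p q, ContDiff ℝ r fun x => G x p q) : ContDiff ℝ r G := by
  classical
  rw [funext fun x => Matrix.matrix_eq_sum_single (G x)]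
  exact ContDiff.sum fun p _ => ContDiff.sum fun q _ =>
    (LinearMap.toContinuousLinearMap (Matrix.singleLinearMap ℝ p q :
      ℂ →ₗ[ℝ] Matrix n n ℂ)).contDiff.comp (hG p q)

namespace IsTorusField

protected theorem isSmoothPeriodic (hM : IsTorusField ℓ M) : IsSmoothPeriodic ℓ M :=
  ⟨contDiff_matrix_of_entries hM.smooth, fun j x => hM.periodic x j⟩

theorem coordDeriv_eq (hM : IsTorusField ℓ M) (j : Fin d) :
    coordDeriv j M = MatrixField.partialDeriv j M := by
  ext x p q
  exact (hM.isSmoothPeriodic.coordDeriv_clm_comp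
    (Matrix.entryLinearMap ℝ ℂ p q).toContinuousLinearMap j x).symm

theorem isHermitian_partialDeriv (hM : IsTorusField ℓ M) (j : Fin d) (x : Fin d → ℝ) :
    (MatrixField.partialDeriv j M x).IsHermitian := by
  have hstar : (fun y => star (M y)) = M := funext hM.hermitian
  rw [← hM.coordDeriv_eq]
  exact (coordDeriv_star j M x).symm.trans (congrArg (coordDeriv j · x) hstar)

end IsTorusField

theorem isHermitian_I_smul_commutator {n : Type*} [Fintype n] {X Y : Matrix n n ℂ}
    (hX : X.IsHermitian) (hY : Y.IsHermitian) : (Complex.I • (X * Y - Y * X)).IsHermitian := by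
  rw [Matrix.IsHermitian, Matrix.conjTranspose_smul, Matrix.conjTranspose_sub,
    Matrix.conjTranspose_mul, Matrix.conjTranspose_mul, hX.eq, hY.eq, Complex.star_def,
    Complex.conj_I, neg_smul, ← smul_neg, neg_sub]

namespace MatrixField

theorem isHermitian_covDeriv (hA : ∀ j, IsTorusField ℓ (A j)) (hh : IsTorusField ℓ h) (j : Fin d)
    (x : Fin d → ℝ) : (covDeriv A j h x).IsHermitian :=
  (hh.isHermitian_partialDeriv j x).add
    (isHermitian_I_smul_commutator ((hA j).hermitian x) (hh.hermitian x))

theorem isHermitian_curvature (hA : ∀ j, IsTorusField ℓ (A j)) (i j : Fin d) (x : Fin d → ℝ) :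
    (curvature A i j x).IsHermitian :=
  (((hA j).isHermitian_partialDeriv i x).sub ((hA i).isHermitian_partialDeriv j x)).add
    (isHermitian_I_smul_commutator ((hA i).hermitian x) ((hA j).hermitian x))

theorem isSmoothPeriodic_covDeriv (hA : ∀ j, IsTorusField ℓ (A j)) (hh : IsTorusField ℓ h)
    (j : Fin d) : IsSmoothPeriodic ℓ (covDeriv A j h) := by
  have hA' := (hA j).isSmoothPeriodic
  have hh' := hh.isSmoothPeriodic
  have hderiv := hh'.coordDeriv j
  rw [hh.coordDeriv_eq] at hderiv
  exact hderiv.add (((hA'.mul hh').sub (hh'.mul hA')).const_smul Complex.I)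

theorem isSmoothPeriodic_curvature (hA : ∀ j, IsTorusField ℓ (A j)) (i j : Fin d) :
    IsSmoothPeriodic ℓ (curvature A i j) := by
  have hA' := fun j => (hA j).isSmoothPeriodic
  have hderiv := fun i j => (hA' j).coordDeriv i
  simp only [(hA _).coordDeriv_eq] at hderiv
  exact ((hderiv i j).sub (hderiv j i)).add
    ((((hA' i).mul (hA' j)).sub ((hA' j).mul (hA' i))).const_smul Complex.I)

/-- The connection form `X_j = i A_j` of the gauge potential `A`, so that `D_j = ∂_j + [X_j, ·]`. -/
def connection (A : Fin d → MatrixField d N) (j : Fin d) : MatrixField d N :=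
  fun x => Complex.I • A j x

theorem isSmoothPeriodic_connection (hA : ∀ j, IsTorusField ℓ (A j)) (j : Fin d) :
    IsSmoothPeriodic ℓ (connection A j) :=
  (hA j).isSmoothPeriodic.const_smul Complex.I

theorem coordDeriv_connection (hA : ∀ j, IsTorusField ℓ (A j)) (i j : Fin d) (x : Fin d → ℝ) :
    coordDeriv i (connection A j) x = Complex.I • partialDeriv i (A j) x := by
  rw [← (hA j).coordDeriv_eq]
  exact (hA j).isSmoothPeriodic.coordDeriv_clm_comp
    (Complex.I • ContinuousLinearMap.id ℝ (Matrix (Fin N) (Fin N) ℂ)) i x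

theorem gaugeLink_connection_mem_unitary (hA : ∀ j, IsTorusField ℓ (A j)) (a : ℝ) (j : Fin d)
    (x : Fin d → ℝ) : gaugeLink (connection A) a j x ∈ unitary (Matrix (Fin N) (Fin N) ℂ) :=
  NormedSpace.exp_mem_unitary_of_mem_skewAdjoint <| skewAdjoint.smul_mem a <|
    ((hA j).hermitian x).isSelfAdjoint.smul_mem_skewAdjoint Complex.conj_I

variable {α : Type*} {l : Filter α} {a : α → ℝ}

theorem plaquetteDefect_connection_isBigO (hℓ : 0 < ℓ) (hA : ∀ j, IsTorusField ℓ (A j))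
    (ha : Tendsto a l (𝓝[>] 0)) (i j : Fin d) (x : α → Fin d → ℝ) :
    (fun p => plaquetteDefect (connection A) (a p) i j (x p) -
      a p ^ 2 • (Complex.I • curvature A i j (x p))) =O[l] fun p => a p ^ 3 := by
  refine (plaquetteDefect_isBigO hℓ (isSmoothPeriodic_connection hA) ha i j x).congr_left
    fun p => ?_
  rw [coordDeriv_connection hA, coordDeriv_connection hA]
  simp only [connection, curvature, smul_mul_smul_comm, Complex.I_mul_I, smul_add, smul_sub,
    smul_smul]

theorem higgsDefect_connection_isBigO (hℓ : 0 < ℓ) (hA : ∀ j, IsTorusField ℓ (A j))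
    (hh : IsTorusField ℓ h) (ha : Tendsto a l (𝓝[>] 0)) (j : Fin d) (x : α → Fin d → ℝ) :
    (fun p => higgsDefect (connection A) h (a p) j (x p) - a p • covDeriv A j h (x p)) =O[l]
      fun p => a p ^ 2 := by
  refine (higgsDefect_isBigO hℓ (isSmoothPeriodic_connection hA j) hh.isSmoothPeriodic ha
    x).congr_left fun p => ?_
  simp only [hh.coordDeriv_eq, connection, covDeriv, smul_mul_assoc, mul_smul_comm, smul_sub]

theorem trace_isBigO {X : α → Matrix (Fin N) (Fin N) ℂ} {g : α → ℝ} (hX : X =O[l] g) :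
    (fun p => (X p).trace) =O[l] g :=
  ((Matrix.traceLinearMap (Fin N) ℂ ℂ).toContinuousLinearMap.isBigO_comp X l).trans hX

theorem trace_plaquetteDefect_isBigO (hℓ : 0 < ℓ) (hA : ∀ j, IsTorusField ℓ (A j))
    (ha : Tendsto a l (𝓝[>] 0)) (i j : Fin d) (x : α → Fin d → ℝ) :
    (fun p => (plaquetteDefect (connection A) (a p) i j (x p) *
        (plaquetteDefect (connection A) (a p) i j (x p))ᴴ).trace -
      a p ^ 4 • (curvature A i j (x p) ^ 2).trace) =O[l] fun p => a p ^ 5 := by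
  have hF := (isSmoothPeriodic_curvature hA i j).const_smul Complex.I
  refine (trace_isBigO (isBigO_mul_star_sub (tendsto_nhds_of_tendsto_nhdsWithin ha)
    (hF.isBigO_one hℓ x)
    (plaquetteDefect_connection_isBigO hℓ hA ha i j x))).congr_left fun p => ?_
  rw [Matrix.star_eq_conjTranspose, Matrix.star_eq_conjTranspose, Matrix.conjTranspose_smul,
    (isHermitian_curvature hA i j (x p)).eq, smul_mul_smul_comm, Matrix.trace_sub,
    Matrix.trace_smul]
  simp [sq]

theorem trace_higgsDefect_isBigO (hℓ : 0 < ℓ) (hA : ∀ j, IsTorusField ℓ (A j))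
    (hh : IsTorusField ℓ h) (ha : Tendsto a l (𝓝[>] 0)) (j : Fin d) (x : α → Fin d → ℝ) :
    (fun p => (higgsDefect (connection A) h (a p) j (x p) *
        (higgsDefect (connection A) h (a p) j (x p))ᴴ).trace -
      a p ^ 2 • (covDeriv A j h (x p) ^ 2).trace) =O[l] fun p => a p ^ 3 := by
  refine (trace_isBigO (isBigO_mul_star_sub (k := 1) (tendsto_nhds_of_tendsto_nhdsWithin ha)
    ((isSmoothPeriodic_covDeriv hA hh j).isBigO_one hℓ x)
    (by simpa using higgsDefect_connection_isBigO hℓ hA hh ha j x))).congr_left fun p => ?_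
  rw [Matrix.star_eq_conjTranspose, Matrix.star_eq_conjTranspose,
    (isHermitian_covDeriv hA hh j (x p)).eq, ← sq, Matrix.trace_sub, Matrix.trace_smul]

end MatrixField

end MatrixField

/-! ## Traces of powers of hopping operators -/

section TracialExpansion

variable {K B : Type*} [CommRing K] [Ring B] [Module K B] {τ : B →ₗ[K] K}

theorem tracial_mul_four_cycle (hτ : ∀ x y, τ (x * y) = τ (y * x)) (a b c e : B) :
    τ (a * b * c * e) = τ (e * a * b * c) := by
  rw [hτ, mul_assoc, mul_assoc, mul_assoc]

theorem tracial_add_sq (hτ : ∀ x y, τ (x * y) = τ (y * x)) (T y : B) :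
    τ ((T + y) ^ 2) = τ (T * T) + 2 * τ (T * y) + τ (y ^ 2) := by
  simp only [pow_succ, pow_zero, one_mul, mul_add, add_mul, map_add]
  linear_combination -hτ T y

theorem tracial_add_cube (hτ : ∀ x y, τ (x * y) = τ (y * x)) (T y : B) :
    τ ((T + y) ^ 3) = τ (T * T * T) + 3 * τ (T * T * y) + 3 * τ (T * y ^ 2) + τ (y ^ 3) := by
  have cycle (a b c : B) : τ (a * b * c) = τ (c * a * b) := by rw [hτ, mul_assoc]
  simp only [pow_succ, pow_zero, one_mul, mul_add, add_mul, map_add, ← mul_assoc]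
  linear_combination -2 * cycle T T y - cycle y T T - 2 * cycle T y y - cycle y T y

theorem tracial_add_fourth (hτ : ∀ x y, τ (x * y) = τ (y * x)) (T y : B) :
    τ ((T + y) ^ 4) = τ (T * T * T * T) + 4 * τ (T * T * T * y) + 4 * τ (T * T * y ^ 2) +
      2 * τ (T * y * T * y) + 4 * τ (T * y ^ 3) + τ (y ^ 4) := by
  have cycle := tracial_mul_four_cycle hτ
  simp only [pow_succ, pow_zero, one_mul, mul_add, add_mul, map_add, ← mul_assoc]
  linear_combination -3 * cycle T T T y - 2 * cycle y T T T - cycle T y T T - 3 * cycle T T y y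
    - 2 * cycle y T T y - cycle y y T T - cycle T y T y - 3 * cycle T y y y - 2 * cycle y T y y
    - cycle y y T y

end TracialExpansion

section SignedDirections

variable {ι : Type*}

/-- The reverse of a signed direction; `(j, true)` is the positive and `(j, false)` the negative
`j`-th direction. -/
def oppositeDir (σ : ι × Bool) : ι × Bool := (σ.1, !σ.2)

@[simp]
theorem oppositeDir_oppositeDir (σ : ι × Bool) : oppositeDir (oppositeDir σ) = σ := by
  simp [oppositeDir]

@[simp]
theorem oppositeDir_ne (σ : ι × Bool) : oppositeDir σ ≠ σ := fun h => by
  simpa [oppositeDir] using congrArg Prod.snd h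

theorem oppositeDir_injective : Function.Injective (oppositeDir (ι := ι)) :=
  Function.LeftInverse.injective oppositeDir_oppositeDir

end SignedDirections

/-- Invertible hopping operators `S σ` in the signed directions `σ`, an on-site operator `y`, and a
tracial functional `τ` which vanishes on the words in them that do not return to their starting
point. Only the words needed for the traces of the first four powers of `∑ σ, S σ + y` are
listed. -/
structure IsHoppingTrace {ι K B : Type*} [CommRing K] [Ring B] [Module K B] (τ : B →ₗ[K] K)
    (S : ι × Bool → B) (y : B) : Prop where
  trace_mul_comm : ∀ x z, τ (x * z) = τ (z * x)
  mul_opposite : ∀ σ, S σ * S (oppositeDir σ) = 1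
  one : ∀ σ k, τ (S σ * y ^ k) = 0
  two : ∀ σ₁ σ₂, σ₂ ≠ oppositeDir σ₁ → ∀ k l, τ (S σ₁ * y ^ k * S σ₂ * y ^ l) = 0
  three : ∀ σ₁ σ₂ σ₃ k, τ (S σ₁ * S σ₂ * S σ₃ * y ^ k) = 0
  four : ∀ σ₁ σ₂ σ₃ σ₄, σ₂ ≠ oppositeDir σ₁ → σ₃ ≠ oppositeDir σ₂ →
    ¬(σ₃ = oppositeDir σ₁ ∧ σ₄ = oppositeDir σ₂) → τ (S σ₁ * S σ₂ * S σ₃ * S σ₄) = 0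

/-- The combination which expresses the trace of `p (∑ σ, S σ + y)`, for hopping operators `S σ` in
`d` dimensions and a quartic polynomial `p`, through the trace `c` of the identity, the total
plaquette term `W`, the total kinetic term `H` of `y`, and the traces `T k` of the powers of `y`. -/
def quarticTrace {K : Type*} [CommRing K] (d : ℕ) (p : Polynomial K) (c W H : K) (T : ℕ → K) : K :=
  c * (p.coeff 0 + 2 * d * p.coeff 2 + (12 * d ^ 2 - 6 * d) * p.coeff 4) -
    2 * p.coeff 4 * (W + H) + (p.coeff 1 + 6 * d * p.coeff 3) * T 1 +
    (p.coeff 2 + 12 * d * p.coeff 4) * T 2 + p.coeff 3 * T 3 + p.coeff 4 * T 4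

theorem mul_quarticTrace {K : Type*} [CommRing K] (z : K) (d : ℕ) (p : Polynomial K) (c W H : K)
    (T : ℕ → K) :
    z * quarticTrace d p c W H T = quarticTrace d p (z * c) (z * W) (z * H) fun k => z * T k := by
  simp only [quarticTrace]
  ring

namespace IsHoppingTrace

section Module

variable {ι K B : Type*} [CommRing K] [Ring B] [Module K B] {τ : B →ₗ[K] K}
  {S : ι × Bool → B} {y : B}

theorem true_mul_false (H : IsHoppingTrace τ S y) (j : ι) : S (j, true) * S (j, false) = 1 :=
  H.mul_opposite (j, true)

theorem false_mul_true (H : IsHoppingTrace τ S y) (j : ι) : S (j, false) * S (j, true) = 1 :=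
  H.mul_opposite (j, false)

theorem mul_four_eq_ite [DecidableEq ι] (H : IsHoppingTrace τ S y) {σ₁ σ₂ : ι × Bool}
    (h : σ₂ ≠ oppositeDir σ₁) (σ₃ σ₄ : ι × Bool) :
    τ (S σ₁ * S σ₂ * S σ₃ * S σ₄) =
      (if σ₃ = oppositeDir σ₂ then if σ₄ = oppositeDir σ₁ then τ 1 else 0 else 0) +
        if σ₃ = oppositeDir σ₁ then if σ₄ = oppositeDir σ₂ then
          if σ₂ = σ₁ then 0 else τ (S σ₁ * S σ₂ * S (oppositeDir σ₁) * S (oppositeDir σ₂))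
          else 0 else 0 := by
  by_cases h₃ : σ₃ = oppositeDir σ₂
  · subst h₃
    rw [mul_assoc (S σ₁), H.mul_opposite, mul_one]
    by_cases h₄ : σ₄ = oppositeDir σ₁
    · simp +contextual [h₄, H.mul_opposite, oppositeDir_injective.eq_iff]
    · have hzero : τ (S σ₁ * S σ₄) = 0 := by simpa using H.two σ₁ σ₄ h₄ 0 0
      simp +contextual [h₄, hzero, oppositeDir_injective.eq_iff]
  · by_cases h₃₄ : σ₃ = oppositeDir σ₁ ∧ σ₄ = oppositeDir σ₂
    · obtain ⟨rfl, rfl⟩ := h₃₄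
      have hne : σ₂ ≠ σ₁ := fun e => h₃ (by rw [e])
      simp [hne, hne.symm, oppositeDir_injective.eq_iff]
    · rw [H.four σ₁ σ₂ σ₃ σ₄ h h₃ h₃₄]
      grind

theorem lie_mul_lie (H : IsHoppingTrace τ S y) (i j : ι) :
    τ (⁅S (i, true), S (j, true)⁆ * ⁅S (j, false), S (i, false)⁆) =
      2 * τ 1 - τ (S (i, true) * S (j, true) * S (i, false) * S (j, false)) -
        τ (S (j, true) * S (i, true) * S (j, false) * S (i, false)) := by
  have cancel (i j : ι) : S (i, true) * S (j, true) * (S (j, false) * S (i, false)) = 1 := by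
    rw [mul_assoc, ← mul_assoc (S (j, true)), H.true_mul_false, one_mul,
      H.true_mul_false]
  simp only [Ring.lie_def, sub_mul, mul_sub, map_sub, cancel]
  simp only [← mul_assoc]
  ring

theorem lie_self_mul_lie_self (H : IsHoppingTrace τ S y) (j : ι) :
    τ (⁅S (j, true), y⁆ * ⁅y, S (j, false)⁆) =
      2 * τ (y ^ 2) - (τ (S (j, true) * y * S (j, false) * y) +
        τ (S (j, false) * y * S (j, true) * y)) := by
  have cycle := tracial_mul_four_cycle H.trace_mul_comm
  have outer : τ (S (j, true) * y * y * S (j, false)) = τ (y ^ 2) := by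
    rw [cycle, H.false_mul_true, one_mul, sq]
  have inner : τ (y * S (j, true) * S (j, false) * y) = τ (y ^ 2) := by
    rw [mul_assoc y, H.true_mul_false, mul_one, sq]
  simp only [Ring.lie_def, sub_mul, mul_sub, map_sub, ← mul_assoc]
  linear_combination outer + inner - cycle y (S (j, true)) y (S (j, false))

variable [Fintype ι]

theorem sum_mul_pow (H : IsHoppingTrace τ S y) (k : ℕ) : τ ((∑ σ, S σ) * y ^ k) = 0 := by
  simp [Finset.sum_mul, H.one]

theorem sum_mul_sum_mul (H : IsHoppingTrace τ S y) (k l : ℕ) :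
    τ ((∑ σ, S σ) * y ^ k * (∑ σ, S σ) * y ^ l) =
      ∑ σ, τ (S σ * y ^ k * S (oppositeDir σ) * y ^ l) := by
  simp only [Finset.sum_mul, Finset.mul_sum, map_sum]
  rw [Finset.sum_comm]
  exact Finset.sum_congr rfl fun σ _ =>
    Finset.sum_eq_single _ (fun σ' _ h => H.two σ σ' h k l) (by simp)

theorem sum_sq_mul (H : IsHoppingTrace τ S y) (k : ℕ) :
    τ ((∑ σ, S σ) * (∑ σ, S σ) * y ^ k) = 2 * Fintype.card ι * τ (y ^ k) := by
  have hpair := H.sum_mul_sum_mul 0 k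
  simp only [pow_zero, mul_one, H.mul_opposite, one_mul] at hpair
  simp only [hpair, Finset.sum_const, Finset.card_univ, Fintype.card_prod, Fintype.card_bool,
    nsmul_eq_mul]
  push_cast
  ring

theorem sum_cube_mul (H : IsHoppingTrace τ S y) (k : ℕ) :
    τ ((∑ σ, S σ) * (∑ σ, S σ) * (∑ σ, S σ) * y ^ k) = 0 := by
  simp [Finset.sum_mul, Finset.mul_sum, H.three]

theorem sum_backtrack (H : IsHoppingTrace τ S y) (σ : ι × Bool) :
    ∑ σ₃, ∑ σ₄, τ (S σ * S (oppositeDir σ) * S σ₃ * S σ₄) = 2 * Fintype.card ι * τ 1 := by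
  have hsq := H.sum_sq_mul 0
  rw [pow_zero, mul_one, Finset.sum_mul_sum] at hsq
  simpa only [H.mul_opposite, one_mul, map_sum] using hsq

theorem sum_of_ne_opposite [DecidableEq ι] (H : IsHoppingTrace τ S y) {σ₁ σ₂ : ι × Bool}
    (h : σ₂ ≠ oppositeDir σ₁) :
    ∑ σ₃, ∑ σ₄, τ (S σ₁ * S σ₂ * S σ₃ * S σ₄) =
      τ 1 + τ (S σ₁ * S σ₂ * S (oppositeDir σ₁) * S (oppositeDir σ₂)) -
        if σ₂ = σ₁ then τ 1 else 0 := by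
  have sum_ite (α β : ι × Bool) (c : K) :
      ∑ σ₃, ∑ σ₄, (if σ₃ = α then if σ₄ = β then c else 0 else 0) = c := by
    rw [Finset.sum_eq_single α (fun σ _ hσ => by simp [hσ]) (by simp)]
    simp
  rw [Finset.sum_congr rfl fun σ₃ _ => Finset.sum_congr rfl fun σ₄ _ => H.mul_four_eq_ite h σ₃ σ₄]
  simp only [Finset.sum_add_distrib, sum_ite]
  by_cases hσ : σ₂ = σ₁
  · subst hσ
    simp [mul_assoc (S σ₂), H.mul_opposite]
  · simp [hσ]

theorem sum_mul_mul [DecidableEq ι] (H : IsHoppingTrace τ S y) (σ₁ σ₂ : ι × Bool) :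
    ∑ σ₃, ∑ σ₄, τ (S σ₁ * S σ₂ * S σ₃ * S σ₄) =
      τ 1 + τ (S σ₁ * S σ₂ * S (oppositeDir σ₁) * S (oppositeDir σ₂)) -
        (if σ₂ = σ₁ then τ 1 else 0) +
        if σ₂ = oppositeDir σ₁ then (2 * Fintype.card ι - 2) * τ 1 else 0 := by
  by_cases h : σ₂ = oppositeDir σ₁
  · subst h
    rw [H.sum_backtrack, H.mul_opposite, one_mul, H.mul_opposite,
      if_neg (oppositeDir_ne σ₁), if_pos rfl]
    ring
  · rw [H.sum_of_ne_opposite h, if_neg h, add_zero]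

theorem sum_plaquette (H : IsHoppingTrace τ S y) :
    ∑ σ₁, ∑ σ₂, τ (S σ₁ * S σ₂ * S (oppositeDir σ₁) * S (oppositeDir σ₂)) =
      2 * ∑ i, ∑ j, (τ (S (i, true) * S (j, true) * S (i, false) * S (j, false)) +
        τ (S (j, true) * S (i, true) * S (j, false) * S (i, false))) := by
  have cycle := tracial_mul_four_cycle H.trace_mul_comm
  simp only [Fintype.sum_prod_type, Fintype.sum_bool, oppositeDir, Bool.not_true, Bool.not_false,
    ← Finset.sum_add_distrib, Finset.mul_sum]
  refine Finset.sum_congr rfl fun i _ => Finset.sum_congr rfl fun j _ => ?_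
  linear_combination cycle (S (i, true)) (S (j, false)) (S (i, false)) (S (j, true)) -
    cycle (S (j, true)) (S (i, true)) (S (j, false)) (S (i, false)) -
    cycle (S (i, true)) (S (j, true)) (S (i, false)) (S (j, false)) -
    cycle (S (j, false)) (S (i, true)) (S (j, true)) (S (i, false))

theorem sum_fourth (H : IsHoppingTrace τ S y) :
    τ ((∑ σ, S σ) * (∑ σ, S σ) * (∑ σ, S σ) * (∑ σ, S σ)) =
      (12 * Fintype.card ι ^ 2 - 6 * Fintype.card ι) * τ 1 -
        2 * ∑ i, ∑ j, τ (⁅S (i, true), S (j, true)⁆ * ⁅S (j, false), S (i, false)⁆) := by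
  classical
  have expand : τ ((∑ σ, S σ) * (∑ σ, S σ) * (∑ σ, S σ) * (∑ σ, S σ)) =
      ∑ σ₁, ∑ σ₂, ∑ σ₃, ∑ σ₄, τ (S σ₁ * S σ₂ * S σ₃ * S σ₄) := by
    simp only [← map_sum, ← Finset.mul_sum, ← Finset.sum_mul]
  simp only [expand, H.sum_mul_mul, Finset.sum_add_distrib, Finset.sum_sub_distrib,
    H.sum_plaquette, H.lie_mul_lie, Finset.sum_ite_eq', Finset.mem_univ, if_true,
    Finset.sum_const, Finset.card_univ, Fintype.card_prod, Fintype.card_bool, nsmul_eq_mul]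
  push_cast
  ring

theorem sum_mul_self_mul_self (H : IsHoppingTrace τ S y) :
    2 * τ ((∑ σ, S σ) * y * (∑ σ, S σ) * y) = 4 * Fintype.card ι * τ (y ^ 2) -
      2 * ∑ j, τ (⁅S (j, true), y⁆ * ⁅y, S (j, false)⁆) := by
  have hpair := H.sum_mul_sum_mul 1 1
  simp only [pow_one] at hpair
  rw [hpair]
  simp only [H.lie_self_mul_lie_self, Fintype.sum_prod_type, Fintype.sum_bool, oppositeDir,
    Bool.not_true, Bool.not_false, Finset.sum_sub_distrib, Finset.sum_const, Finset.card_univ,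
    nsmul_eq_mul]
  ring

theorem trace_sq (H : IsHoppingTrace τ S y) :
    τ ((∑ σ, S σ + y) ^ 2) = 2 * Fintype.card ι * τ 1 + τ (y ^ 2) := by
  have h₁ := H.sum_mul_pow 1
  have h₂ := H.sum_sq_mul 0
  simp only [pow_zero, mul_one, pow_one] at h₁ h₂
  rw [tracial_add_sq H.trace_mul_comm, h₂, h₁]
  ring

theorem trace_cube (H : IsHoppingTrace τ S y) :
    τ ((∑ σ, S σ + y) ^ 3) = 6 * Fintype.card ι * τ y + τ (y ^ 3) := by
  have h₂ := H.sum_sq_mul 1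
  have h₃ := H.sum_cube_mul 0
  simp only [pow_zero, mul_one, pow_one] at h₂ h₃
  rw [tracial_add_cube H.trace_mul_comm, h₃, h₂, H.sum_mul_pow]
  ring

theorem trace_fourth (H : IsHoppingTrace τ S y) :
    τ ((∑ σ, S σ + y) ^ 4) =
      (12 * Fintype.card ι ^ 2 - 6 * Fintype.card ι) * τ 1 -
        2 * ∑ i, ∑ j, τ (⁅S (i, true), S (j, true)⁆ * ⁅S (j, false), S (i, false)⁆) +
        12 * Fintype.card ι * τ (y ^ 2) -
        2 * ∑ j, τ (⁅S (j, true), y⁆ * ⁅y, S (j, false)⁆) + τ (y ^ 4) := by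
  have h₃ := H.sum_cube_mul 1
  simp only [pow_one] at h₃
  rw [tracial_add_fourth H.trace_mul_comm, h₃, H.sum_mul_pow, H.sum_sq_mul, H.sum_fourth]
  linear_combination H.sum_mul_self_mul_self

end Module

theorem trace_aeval {ι K B : Type*} [Fintype ι] [CommRing K] [Ring B] [Algebra K B] {τ : B →ₗ[K] K}
    {S : ι × Bool → B} {y : B} (H : IsHoppingTrace τ S y) {p : Polynomial K}
    (hp : p.natDegree ≤ 4) :
    τ (Polynomial.aeval (∑ σ, S σ + y) p) = quarticTrace (Fintype.card ι) p (τ 1)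
      (∑ i, ∑ j, τ (⁅S (i, true), S (j, true)⁆ * ⁅S (j, false), S (i, false)⁆))
      (∑ j, τ (⁅S (j, true), y⁆ * ⁅y, S (j, false)⁆)) (fun k => τ (y ^ k)) := by
  have hone : τ (∑ σ, S σ + y) = τ y := by simpa using H.sum_mul_pow 0
  rw [Polynomial.aeval_eq_sum_range' (Nat.lt_succ_of_le hp), map_sum]
  simp only [Finset.sum_range_succ, Finset.sum_range_zero, zero_add, map_smul, pow_zero, pow_one,
    hone, H.trace_sq, H.trace_cube, H.trace_fourth, smul_eq_mul, quarticTrace]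
  ring

end IsHoppingTrace

/-! ## Block matrices -/

section BlockShift

variable {V R : Type*} [DecidableEq V] [AddGroup V]

/-- The block matrix with the entry `K v` at each position `(v, v + g)` and zeros elsewhere. -/
def blockShift [Zero R] (g : V) (K : V → R) : Matrix V V R :=
  Matrix.of fun v w => if w = v + g then K v else 0

theorem blockShift_apply [Zero R] (g : V) (K : V → R) (v w : V) :
    blockShift g K v w = if w = v + g then K v else 0 := rfl

theorem star_blockShift [NonUnitalSemiring R] [StarRing R] (g : V) (K : V → R) :
    star (blockShift g K) = blockShift (-g) fun v => star (K (v - g)) := by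
  ext v w
  simp only [Matrix.star_apply, blockShift_apply, ← sub_eq_add_neg, eq_sub_iff_add_eq]
  by_cases h : v = w + g
  · simp [h]
  · simp [h, Ne.symm h]

variable [Ring R]

theorem blockShift_mul [Fintype V] (g g' : V) (K K' : V → R) :
    blockShift g K * blockShift g' K' = blockShift (g + g') fun v => K v * K' (v + g) := by
  ext v w
  rw [Matrix.mul_apply, Finset.sum_eq_single (v + g)]
  · simp [blockShift_apply, add_assoc]
  · intro u _ hu
    simp [blockShift_apply, hu]
  · simp

theorem blockShift_sub (g : V) (K K' : V → R) :
    blockShift g K - blockShift g K' = blockShift g fun v => K v - K' v := by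
  ext v w
  simp only [Matrix.sub_apply, blockShift_apply]
  split_ifs <;> simp

theorem blockShift_zero_one : blockShift (0 : V) (fun _ => (1 : R)) = 1 := by
  ext v w
  simp [blockShift_apply, Matrix.one_apply, eq_comm]

theorem blockShift_zero_pow [Fintype V] (K : V → R) (k : ℕ) :
    blockShift (0 : V) K ^ k = blockShift 0 fun v => K v ^ k := by
  induction k with
  | zero => simp only [pow_zero, blockShift_zero_one]
  | succ k ih => simp [pow_succ, ih, blockShift_mul]

theorem blockShift_mem_unitary [Fintype V] [StarRing R] (g : V) {K : V → R}
    (hK : ∀ v, K v ∈ unitary R) : blockShift g K ∈ unitary (Matrix V V R) := by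
  rw [Unitary.mem_iff, star_blockShift, blockShift_mul, blockShift_mul, neg_add_cancel,
    add_neg_cancel]
  simp [← sub_eq_add_neg, Unitary.star_mul_self_of_mem (hK _),
    Unitary.mul_star_self_of_mem (hK _), blockShift_zero_one]

end BlockShift

theorem star_lie {R : Type*} [Ring R] [StarRing R] (x y : R) : star ⁅x, y⁆ = ⁅star y, star x⁆ := by
  simp only [Ring.lie_def, star_sub, star_mul]

section BlockTrace

open scoped Matrix

variable {V n K : Type*} [Fintype V] [Fintype n] [CommRing K]

variable (V n K) in
/-- The trace of a matrix whose entries are matrices: the sum of the traces of its diagonal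
blocks. -/
def blockTrace : Matrix V V (Matrix n n K) →ₗ[K] K :=
  Matrix.traceLinearMap n K K ∘ₗ Matrix.traceLinearMap V K (Matrix n n K)

theorem blockTrace_apply (X : Matrix V V (Matrix n n K)) :
    blockTrace V n K X = ∑ v, (X v v).trace :=
  Matrix.trace_sum _ _

theorem blockTrace_mul_comm (X Y : Matrix V V (Matrix n n K)) :
    blockTrace V n K (X * Y) = blockTrace V n K (Y * X) := by
  simp only [blockTrace_apply, Matrix.mul_apply, Matrix.trace_sum]
  rw [Finset.sum_comm]
  exact Finset.sum_congr rfl fun v _ => Finset.sum_congr rfl fun w _ => Matrix.trace_mul_comm _ _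

theorem blockTrace_one [DecidableEq V] [DecidableEq n] :
    blockTrace V n K 1 = Fintype.card V * Fintype.card n := by
  simp [blockTrace_apply]

theorem trace_toLin'_comp [DecidableEq V] [DecidableEq n] (X : Matrix V V (Matrix n n K)) :
    LinearMap.trace K _ (Matrix.toLin' (Matrix.comp V V n n K X)) = blockTrace V n K X := by
  rw [Matrix.trace_toLin'_eq, blockTrace_apply]
  simp [Matrix.trace, Fintype.sum_prod_type]

theorem trace_aeval_eq_blockTrace [DecidableEq V] [DecidableEq n] {H : V → Type*}
    [∀ v, AddCommGroup (H v)] [∀ v, Module K (H v)] (u : ∀ v, H v ≃ₗ[K] (n → K))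
    {D : Module.End K (∀ v, H v)} {X : Matrix V V (Matrix n n K)}
    (hX : ∀ ψ v, u v (D ψ v) = ∑ w, X v w *ᵥ u w (ψ w)) (p : Polynomial K) :
    LinearMap.trace K _ (Polynomial.aeval D p) = blockTrace V n K (Polynomial.aeval X p) := by
  set frame : (∀ v, H v) ≃ₗ[K] (V × n → K) :=
    (LinearEquiv.piCongrRight u).trans (LinearEquiv.curry K K V n).symm
  set toEnd := (Matrix.compAlgEquiv V n K K).trans Matrix.toLinAlgEquiv'
  have hframe (ψ : ∀ v, H v) (v : V) (q : n) : frame ψ (v, q) = u v (ψ v) q := rfl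
  have hconj : frame.conjAlgEquiv K D = toEnd X := by
    refine LinearMap.ext fun φ => ?_
    obtain ⟨ψ, rfl⟩ := frame.surjective φ
    rw [LinearEquiv.conjAlgEquiv_apply]
    funext ⟨v, q⟩
    simp only [LinearMap.comp_apply, LinearEquiv.coe_coe, LinearEquiv.symm_apply_apply, hframe, hX]
    simp [toEnd, Matrix.mulVec, dotProduct, Fintype.sum_prod_type, hframe]
  rw [← LinearMap.trace_conj' _ frame, ← trace_toLin'_comp]
  change LinearMap.trace K _ (frame.conjAlgEquiv K _) = LinearMap.trace K _ (toEnd _)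
  rw [← Polynomial.aeval_algHom_apply toEnd, ← Polynomial.aeval_algHom_apply (frame.conjAlgEquiv K),
    hconj]

variable [DecidableEq V] [AddGroup V]

theorem blockTrace_blockShift_zero (X : V → Matrix n n K) :
    blockTrace V n K (blockShift 0 X) = ∑ v, (X v).trace := by
  simp [blockTrace_apply, blockShift_apply]

theorem blockTrace_blockShift_of_ne {g : V} (hg : g ≠ 0) (X : V → Matrix n n K) :
    blockTrace V n K (blockShift g X) = 0 := by
  simp [blockTrace_apply, blockShift_apply, hg]

theorem blockTrace_blockShift_mul_star [StarRing K] (g : V)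
    (X : V → Matrix n n K) :
    blockTrace V n K (blockShift g X * star (blockShift g X)) = ∑ v, (X v * (X v)ᴴ).trace := by
  classical
  rw [star_blockShift, blockShift_mul, add_neg_cancel, blockTrace_blockShift_zero]
  simp [Matrix.star_eq_conjTranspose]

end BlockTrace

/-! ## Lattice words -/

section SignedUnit

variable {ι : Type*} [DecidableEq ι]

/-- The displacement `± 𝐞_j` of a signed direction, with integral or modular coordinates. -/
def signedUnit (R : Type*) [Ring R] (σ : ι × Bool) : ι → R :=
  Pi.single σ.1 (if σ.2 then 1 else -1)

theorem signedUnit_opposite (R : Type*) [Ring R] (σ : ι × Bool) :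
    signedUnit R (oppositeDir σ) = -signedUnit R σ := by
  rcases σ with ⟨j, _ | _⟩ <;> simp [signedUnit, oppositeDir, Pi.single_neg]

theorem intCast_signedUnit (R : Type*) [Ring R] (σ : ι × Bool) (k : ι) :
    (signedUnit ℤ σ k : R) = signedUnit R σ k := by
  rcases σ with ⟨j, _ | _⟩ <;> by_cases hk : k = j <;> simp [signedUnit, hk]

theorem intCast_sum_signedUnit (R : Type*) [Ring R] (l : List (ι × Bool)) (k : ι) :
    (((l.map (signedUnit ℤ)).sum k : ℤ) : R) = (l.map (signedUnit R)).sum k := by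
  induction l with
  | nil => simp
  | cons σ l ih => simp [intCast_signedUnit, ih]

theorem abs_sum_signedUnit_le (l : List (ι × Bool)) (k : ι) :
    |(l.map (signedUnit ℤ)).sum k| ≤ l.length := by
  induction l with
  | nil => simp
  | cons σ l ih =>
    have hσ : |signedUnit ℤ σ k| ≤ 1 := by
      rcases σ with ⟨j, _ | _⟩ <;> by_cases hk : k = j <;> simp [signedUnit, hk]
    simp only [List.map_cons, List.sum_cons, Pi.add_apply, List.length_cons, Nat.cast_succ]
    linarith [abs_add_le (signedUnit ℤ σ k) ((l.map (signedUnit ℤ)).sum k)]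

/-- A word shorter than the period cannot wind around the torus. -/
theorem sum_signedUnit_eq_zero_of_length_lt {m : ℕ} {l : List (ι × Bool)} (hl : l.length < m)
    (h : (l.map (signedUnit (ZMod m))).sum = 0) : (l.map (signedUnit ℤ)).sum = 0 := by
  funext k
  have hcast : (((l.map (signedUnit ℤ)).sum k : ℤ) : ZMod m) = 0 := by
    rw [intCast_sum_signedUnit, h, Pi.zero_apply]
  exact Int.eq_zero_of_abs_lt_dvd ((ZMod.intCast_zmod_eq_zero_iff_dvd _ m).1 hcast)
    ((abs_sum_signedUnit_le l k).trans_lt (by exact_mod_cast hl))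

/-- In the `j`-th coordinate, only the opposite of a step along `± 𝐞_j` can cancel it. -/
theorem oppositeDir_mem_of_sum_signedUnit_eq_zero {σ : ι × Bool} {l : List (ι × Bool)}
    (h : ((σ :: l).map (signedUnit ℤ)).sum = 0) : oppositeDir σ ∈ l := by
  obtain ⟨j, b⟩ := σ
  by_contra hmem
  have nonneg : 0 ≤ signedUnit ℤ (j, b) j * (l.map (signedUnit ℤ)).sum j := by
    clear h
    induction l with
    | nil => simp
    | cons σ' l ih =>
      have hσ' : 0 ≤ signedUnit ℤ (j, b) j * signedUnit ℤ σ' j := by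
        rcases σ' with ⟨i, c⟩
        by_cases hij : i = j
        · subst hij
          cases b <;> cases c <;> simp_all [oppositeDir, signedUnit]
        · simp [signedUnit, Ne.symm hij]
      simp only [List.map_cons, List.sum_cons, Pi.add_apply, mul_add]
      exact add_nonneg hσ' (ih fun hl => hmem (List.mem_cons_of_mem _ hl))
  have hj := congrFun h j
  cases b <;> simp [signedUnit] at hj nonneg <;> omega

theorem even_length_of_sum_signedUnit_eq_zero [Finite ι] {l : List (ι × Bool)}
    (h : (l.map (signedUnit ℤ)).sum = 0) : Even l.length := by
  have := Fintype.ofFinite ι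
  have parity : ∀ l : List (ι × Bool), ∑ k, (l.map (signedUnit (ZMod 2))).sum k = l.length := by
    intro l
    induction l with
    | nil => simp
    | cons σ l ih =>
      have hσ : ∑ k, signedUnit (ZMod 2) σ k = 1 := by
        rcases σ with ⟨j, _ | _⟩ <;> simp [signedUnit]
      simp [Finset.sum_add_distrib, ih, hσ, add_comm]
  rw [← ZMod.natCast_eq_zero_iff_even, ← parity]
  refine Finset.sum_eq_zero fun k _ => ?_
  rw [← intCast_sum_signedUnit, h, Pi.zero_apply, Int.cast_zero]

theorem eq_opposite_of_signedUnit_add_eq_zero {σ₁ σ₂ : ι × Bool}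
    (h : signedUnit ℤ σ₁ + signedUnit ℤ σ₂ = 0) : σ₂ = oppositeDir σ₁ := by
  simpa [eq_comm] using
    oppositeDir_mem_of_sum_signedUnit_eq_zero (σ := σ₁) (l := [σ₂]) (by simpa using h)

theorem opposite_of_sum_four_signedUnit_eq_zero {σ₁ σ₂ σ₃ σ₄ : ι × Bool}
    (h₁₂ : σ₂ ≠ oppositeDir σ₁) (h₂₃ : σ₃ ≠ oppositeDir σ₂)
    (h : ([σ₁, σ₂, σ₃, σ₄].map (signedUnit ℤ)).sum = 0) :
    σ₃ = oppositeDir σ₁ ∧ σ₄ = oppositeDir σ₂ := by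
  have hmem := oppositeDir_mem_of_sum_signedUnit_eq_zero h
  simp only [List.mem_cons, List.not_mem_nil, or_false] at hmem
  simp only [List.map_cons, List.map_nil, List.sum_cons, List.sum_nil, add_zero] at h
  rcases hmem with h₂ | h₃ | h₄
  · exact absurd h₂.symm h₁₂
  · refine ⟨h₃.symm, eq_opposite_of_signedUnit_add_eq_zero ?_⟩
    rw [← h₃, signedUnit_opposite] at h
    rw [← h]
    abel
  · refine absurd (eq_opposite_of_signedUnit_add_eq_zero ?_) h₂₃
    rw [← h₄, signedUnit_opposite] at h
    rw [← h]
    abel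

end SignedUnit

/-! ## Hopping operators on the torus lattice -/

section Hopping

open scoped Matrix

variable {ι : Type*} [Fintype ι] [DecidableEq ι] {m : ℕ}

/-- The hopping operators on `(ℤ/mℤ)^ι` with link variables `U`: in the positive `j`-th direction
the block at `(v, v + 𝐞_j)` is `U j v`, and the negative directions are the adjoints. -/
def hop {R : Type*} [Ring R] [StarRing R] (U : ι → (ι → ZMod m) → R) :
    ι × Bool → Matrix (ι → ZMod m) (ι → ZMod m) R
  | (j, true) => blockShift (Pi.single j 1) (U j)
  | (j, false) => star (blockShift (Pi.single j 1) (U j))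

theorem hop_eq_blockShift {R : Type*} [Ring R] [StarRing R] (U : ι → (ι → ZMod m) → R)
    (σ : ι × Bool) : ∃ Y, hop U σ = blockShift (signedUnit (ZMod m) σ) Y := by
  rcases σ with ⟨j, _ | _⟩
  · exact ⟨fun v => star (U j (v - Pi.single j 1)), by
      simp [hop, star_blockShift, signedUnit, Pi.single_neg]⟩
  · exact ⟨U j, by simp [hop, signedUnit]⟩

variable [NeZero m] {n K : Type*} [Fintype n] [DecidableEq n] [CommRing K] [StarRing K]

theorem isHoppingTrace_hop (hm : 5 ≤ m) {U : ι → (ι → ZMod m) → Matrix n n K}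
    (hU : ∀ j v, U j v ∈ unitary (Matrix n n K)) (y : (ι → ZMod m) → Matrix n n K) :
    IsHoppingTrace (blockTrace (ι → ZMod m) n K) (hop U) (blockShift 0 y) := by
  choose Y hY using hop_eq_blockShift U
  have closed {l : List (ι × Bool)} (hl : l.length ≤ 4) {g : ι → ZMod m}
      (hg : g = (l.map (signedUnit (ZMod m))).sum) (h : g = 0) :
      (l.map (signedUnit ℤ)).sum = 0 :=
    sum_signedUnit_eq_zero_of_length_lt (by lia) (hg ▸ h)
  refine ⟨blockTrace_mul_comm, ?_, fun σ k => ?_, fun σ₁ σ₂ h k l => ?_, fun σ₁ σ₂ σ₃ k => ?_,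
    fun σ₁ σ₂ σ₃ σ₄ h₁ h₂ h₃ => ?_⟩
  · rintro ⟨j, _ | _⟩
    · exact Unitary.star_mul_self_of_mem (blockShift_mem_unitary _ (hU j))
    · exact Unitary.mul_star_self_of_mem (blockShift_mem_unitary _ (hU j))
  all_goals
    simp only [hY, blockShift_zero_pow, blockShift_mul, add_zero]
    refine blockTrace_blockShift_of_ne (fun h₀ => ?_) _
  · simpa using oppositeDir_mem_of_sum_signedUnit_eq_zero (closed (l := [σ]) (by simp) (by simp) h₀)
  · exact h (eq_opposite_of_signedUnit_add_eq_zero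
      (by simpa using closed (l := [σ₁, σ₂]) (by simp) (by simp) h₀))
  · have heven := even_length_of_sum_signedUnit_eq_zero
      (closed (l := [σ₁, σ₂, σ₃]) (by simp) (by simp [add_assoc]) h₀)
    exact absurd heven (show ¬Even 3 by decide)
  · exact h₃ (opposite_of_sum_four_signedUnit_eq_zero h₁ h₂
      (closed (by simp) (by simp [add_assoc]) h₀))

theorem blockTrace_hop_lie_mul_lie (U : ι → (ι → ZMod m) → Matrix n n K) (i j : ι) :
    blockTrace (ι → ZMod m) n K
      (⁅hop U (i, true), hop U (j, true)⁆ * ⁅hop U (j, false), hop U (i, false)⁆) =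
      ∑ v, ((U i v * U j (v + Pi.single i 1) - U j v * U i (v + Pi.single j 1)) *
        (U i v * U j (v + Pi.single i 1) - U j v * U i (v + Pi.single j 1))ᴴ).trace := by
  have hadj : ⁅hop U (j, false), hop U (i, false)⁆ = star ⁅hop U (i, true), hop U (j, true)⁆ :=
    (star_lie _ _).symm
  rw [hadj, Ring.lie_def, hop, hop, blockShift_mul, blockShift_mul,
    add_comm (Pi.single j (1 : ZMod m) : ι → ZMod m), blockShift_sub,
    blockTrace_blockShift_mul_star]

theorem blockTrace_hop_lie_onsite_mul_lie (U : ι → (ι → ZMod m) → Matrix n n K)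
    {y : (ι → ZMod m) → Matrix n n K} (hy : ∀ v, (y v).IsHermitian) (j : ι) :
    blockTrace (ι → ZMod m) n K
      (⁅hop U (j, true), blockShift 0 y⁆ * ⁅blockShift 0 y, hop U (j, false)⁆) =
      ∑ v, ((U j v * y (v + Pi.single j 1) - y v * U j v) *
        (U j v * y (v + Pi.single j 1) - y v * U j v)ᴴ).trace := by
  have hstar : star (blockShift 0 y) = blockShift 0 y := by
    rw [star_blockShift, neg_zero]
    exact congrArg _ (funext fun v => by rw [sub_zero]; exact (hy v).eq)
  have hadj : ⁅blockShift 0 y, hop U (j, false)⁆ = star ⁅hop U (j, true), blockShift 0 y⁆ := by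
    rw [star_lie, hstar, hop, hop]
  rw [hadj, Ring.lie_def, hop, blockShift_mul, blockShift_mul, zero_add, add_zero, blockShift_sub,
    blockTrace_blockShift_mul_star]
  simp only [add_zero]

end Hopping

/-! ## The Dirac operator in lattice frames -/

theorem linearMap_adjoint_eq_symm {E F : Type*} [NormedAddCommGroup E] [NormedAddCommGroup F]
    [InnerProductSpace ℂ E] [InnerProductSpace ℂ F] [FiniteDimensional ℂ E]
    [FiniteDimensional ℂ F] (L : E ≃ₗᵢ[ℂ] F) :
    LinearMap.adjoint L.toLinearEquiv.toLinearMap = L.symm.toLinearEquiv.toLinearMap :=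
  ((LinearMap.eq_adjoint_iff _ _).2 fun x y => by
    simpa using L.symm.inner_map_eq_flip x y).symm

theorem WithLoops.sum_hom {V : Type} [DecidableEq V] [Quiver.{0} V]
    [∀ v w : V, Fintype (v ⟶ w)] {M : Type*} [AddCommMonoid M] {v w : V}
    (g : (of v ⟶ of w) → M) :
    ∑ e, g e = ∑ e : v ⟶ w, g (old e) + ∑ e : PLift (of v = of w), g (Sum.inr e) :=
  Fintype.sum_sum_type g

namespace QuiverRep

variable {V : Type} [Quiver.{0} V] [∀ v w : V, Fintype (v ⟶ w)] (R : QuiverRep (WithLoops V))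
  (ρ : EdgeLength (WithLoops V))

/-- The part of the Dirac block `H_w → H_v` which comes from the edges that are not added
self-loops. -/
noncomputable def edgeBlock (v w : V) : (R.obj (.of w)).H →ₗ[ℂ] (R.obj (.of v)).H :=
  (∑ e : w ⟶ v, R.weight ρ (WithLoops.old e)) +
    ∑ e : v ⟶ w, LinearMap.adjoint (R.weight ρ (WithLoops.old e))

variable [DecidableEq V]

theorem diracBlock_self (v : V) :
    R.diracBlock ρ (.of v) (.of v) = R.edgeBlock ρ v v + R.higgs ρ (.of v) := by
  have loop_only {M : Type} [AddCommMonoid M] (g : PLift (WithLoops.of v = .of v) → M) :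
      ∑ e, g e = g ⟨rfl⟩ :=
    Fintype.sum_subsingleton g ⟨rfl⟩
  rw [diracBlock, WithLoops.sum_hom, WithLoops.sum_hom, loop_only, loop_only, add_add_add_comm]
  rfl

theorem diracBlock_of_ne {v w : V} (h : v ≠ w) :
    R.diracBlock ρ (.of v) (.of w) = R.edgeBlock ρ v w := by
  have no_loop {w v : V} (h : v ≠ w) {M : Type} [AddCommMonoid M]
      (g : PLift (WithLoops.of v = .of w) → M) : ∑ e, g e = 0 :=
    Finset.sum_eq_zero fun e _ => absurd e.down h
  rw [diracBlock, WithLoops.sum_hom, WithLoops.sum_hom, no_loop h, no_loop h.symm, add_zero,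
    add_zero]
  rfl

end QuiverRep

namespace TorusLattice

variable {d m : ℕ}

/-- The coordinates of a vertex, as an element of the group `(ℤ/mℤ)^d`. -/
def coord (v : TorusLattice d m) : Fin d → ZMod m := v

theorem coord_shift (v : TorusLattice d m) (j : Fin d) :
    (v.shift j).coord = v.coord + Pi.single j 1 := by
  funext k
  rw [Pi.add_apply, Pi.single_apply]
  rfl

theorem shift_eq_iff {v w : TorusLattice d m} {j : Fin d} :
    v.shift j = w ↔ w.coord = v.coord + Pi.single j 1 := by
  rw [← coord_shift]
  exact eq_comm

theorem sum_hom {M : Type*} [AddCommMonoid M] (v w : TorusLattice d m) (g : Fin d → M) :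
    ∑ e : v ⟶ w, g e.1 = ∑ j, if w.coord = v.coord + Pi.single j 1 then g j else 0 := by
  simp only [← shift_eq_iff]
  rw [← Finset.sum_filter]
  exact (Finset.sum_subtype {j | v.shift j = w} (by simp) g).symm

end TorusLattice

section LatticeDirac

open scoped Matrix.Norms.Frobenius

variable {d m N : ℕ}

/-- The link variables `exp (i a A_j(v))` of the lattice with spacing `a`. -/
noncomputable def latticeLink (A : Fin d → MatrixField d N) (a : ℝ) (j : Fin d)
    (v : Fin d → ZMod m) : Matrix (Fin N) (Fin N) ℂ :=
  gaugeLink (MatrixField.connection A) a j (latticePoint a v)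

/-- The diagonal blocks `a h(v)` of `a D` on the lattice with spacing `a`. -/
noncomputable def latticeHiggs (h : MatrixField d N) (a : ℝ) (v : Fin d → ZMod m) :
    Matrix (Fin N) (Fin N) ℂ :=
  (a : ℂ) • h (latticePoint a v)

/-- The block matrix of `a D` for the fields sampled from `A` and `h`. -/
noncomputable def latticeDirac (m : ℕ) (A : Fin d → MatrixField d N) (h : MatrixField d N)
    (a : ℝ) : Matrix (Fin d → ZMod m) (Fin d → ZMod m) (Matrix (Fin N) (Fin N) ℂ) :=
  ∑ σ, hop (latticeLink A a) σ + blockShift 0 (latticeHiggs h a)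

theorem sum_hop_apply {R : Type*} [Ring R] [StarRing R] (U : Fin d → (Fin d → ZMod m) → R)
    (v w : Fin d → ZMod m) :
    (∑ σ, hop U σ) v w = (∑ j, if v = w + Pi.single j 1 then star (U j w) else 0) +
      ∑ j, if w = v + Pi.single j 1 then U j v else 0 := by
  simp only [Fintype.sum_prod_type, Fintype.sum_bool, Finset.sum_add_distrib, Matrix.sum_apply,
    hop, Matrix.star_apply, blockShift_apply, apply_ite star, star_zero]
  exact add_comm _ _

end LatticeDirac

namespace IsLatticeSample

open scoped Matrix.Norms.Frobenius

variable {d m N : ℕ} {a ℓ : ℝ} {A : Fin d → MatrixField d N} {h : MatrixField d N}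
  {R : QuiverRep (LoopedTorus d m)} {ρ : EdgeLength (LoopedTorus d m)}
  {u : ∀ v, (R.obj v).H ≃ₗᵢ[ℂ] EuclideanSpace ℂ (Fin N)}

theorem link_symm (hS : IsLatticeSample a A h R ρ u) (v : TorusLattice d m) (j : Fin d)
    (x : (R.obj (.of (v.shift j))).H) :
    u (.of v) ((R.link (WithLoops.old (v.edge j))).symm x) =
      Matrix.toEuclideanLin (latticeLink A a j v.coord) (u (.of (v.shift j)) x) := by
  have hgauge := hS.gauge v j (u (.of (v.shift j)) x)
  rw [LinearIsometryEquiv.symm_apply_apply] at hgauge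
  rw [hgauge, latticeLink, gaugeLink, MatrixField.connection, mul_comm, mul_smul]
  rfl

theorem smul_adjoint_weight (hS : IsLatticeSample a A h R ρ u) (ha : a ≠ 0)
    {v w : TorusLattice d m} (e : v ⟶ w) (x : (R.obj (.of w)).H) :
    (a : ℂ) • u (.of v) (LinearMap.adjoint (R.weight ρ (WithLoops.old e)) x) =
      Matrix.toEuclideanLin (latticeLink A a e.1 v.coord) (u (.of w) x) := by
  obtain ⟨j, rfl⟩ := e
  have ha' : (a : ℂ) ≠ 0 := Complex.ofReal_ne_zero.2 ha
  rw [← hS.link_symm, QuiverRep.weight, hS.spacing, map_smulₛₗ, linearMap_adjoint_eq_symm]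
  simp only [LinearMap.smul_apply, map_smul, smul_smul, map_inv₀, Complex.conj_ofReal,
    mul_inv_cancel₀ ha', one_smul]
  rfl

theorem smul_weight (hS : IsLatticeSample a A h R ρ u) (ha : a ≠ 0)
    (hA : ∀ j, IsTorusField ℓ (A j)) {v w : TorusLattice d m} (e : v ⟶ w)
    (x : (R.obj (.of v)).H) :
    (a : ℂ) • u (.of w) (R.weight ρ (WithLoops.old e) x) =
      Matrix.toEuclideanLin (star (latticeLink A a e.1 v.coord)) (u (.of v) x) := by
  obtain ⟨j, rfl⟩ := e
  have ha' : (a : ℂ) ≠ 0 := Complex.ofReal_ne_zero.2 ha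
  have hlink := hS.link_symm v j (R.link (WithLoops.old (v.edge j)) x)
  rw [LinearIsometryEquiv.symm_apply_apply] at hlink
  have hunitary : star (latticeLink A a j v.coord) * latticeLink A a j v.coord = 1 :=
    Unitary.star_mul_self_of_mem (MatrixField.gaugeLink_connection_mem_unitary hA a j _)
  rw [QuiverRep.weight, hS.spacing, hlink]
  simp only [LinearMap.smul_apply, map_smul, smul_smul, mul_inv_cancel₀ ha', one_smul]
  change u (.of (v.shift j)) (R.link (WithLoops.old (v.edge j)) x) =
    Matrix.toEuclideanLin (star (latticeLink A a j v.coord))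
      (Matrix.toEuclideanLin (latticeLink A a j v.coord) _)
  rw [Matrix.toLpLin_apply, Matrix.toLpLin_apply]
  simp only [Matrix.mulVec_mulVec, hunitary, Matrix.one_mulVec]

theorem smul_sum_weight (hS : IsLatticeSample a A h R ρ u) (ha : a ≠ 0)
    (hA : ∀ j, IsTorusField ℓ (A j)) (v w : TorusLattice d m) (x : (R.obj (.of v)).H) :
    (a : ℂ) • u (.of w) ((∑ e : v ⟶ w, R.weight ρ (WithLoops.old e)) x) =
      Matrix.toEuclideanLin (∑ j, if w.coord = v.coord + Pi.single j 1 then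
        star (latticeLink A a j v.coord) else 0) (u (.of v) x) := by
  rw [← TorusLattice.sum_hom, LinearMap.sum_apply, map_sum, map_sum, LinearMap.sum_apply,
    Finset.smul_sum]
  exact Finset.sum_congr rfl fun e _ => hS.smul_weight ha hA e x

theorem smul_sum_adjoint_weight (hS : IsLatticeSample a A h R ρ u) (ha : a ≠ 0)
    (v w : TorusLattice d m) (x : (R.obj (.of w)).H) :
    (a : ℂ) • u (.of v) ((∑ e : v ⟶ w, LinearMap.adjoint (R.weight ρ (WithLoops.old e))) x) =
      Matrix.toEuclideanLin (∑ j, if w.coord = v.coord + Pi.single j 1 then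
        latticeLink A a j v.coord else 0) (u (.of w) x) := by
  rw [← TorusLattice.sum_hom, LinearMap.sum_apply, map_sum, map_sum, LinearMap.sum_apply,
    Finset.smul_sum]
  exact Finset.sum_congr rfl fun e _ => hS.smul_adjoint_weight ha e x

theorem smul_edgeBlock (hS : IsLatticeSample a A h R ρ u) (ha : a ≠ 0)
    (hA : ∀ j, IsTorusField ℓ (A j)) (v w : TorusLattice d m) (x : (R.obj (.of w)).H) :
    (a : ℂ) • u (.of v) (R.edgeBlock ρ v w x) =
      Matrix.toEuclideanLin ((∑ σ, hop (latticeLink A a) σ) v.coord w.coord) (u (.of w) x) := by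
  rw [sum_hop_apply, map_add, LinearMap.add_apply, ← hS.smul_sum_weight ha hA,
    ← hS.smul_sum_adjoint_weight ha, QuiverRep.edgeBlock, LinearMap.add_apply, map_add, smul_add]

theorem smul_diracBlock (hS : IsLatticeSample a A h R ρ u) (ha : a ≠ 0)
    (hA : ∀ j, IsTorusField ℓ (A j)) (v w : TorusLattice d m) (x : (R.obj (.of w)).H) :
    (a : ℂ) • u (.of v) (R.diracBlock ρ (.of v) (.of w) x) =
      Matrix.toEuclideanLin (latticeDirac m A h a v.coord w.coord) (u (.of w) x) := by
  rw [latticeDirac, Matrix.add_apply, map_add, LinearMap.add_apply, ← hS.smul_edgeBlock ha hA,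
    blockShift_apply, add_zero]
  by_cases hvw : v = w
  · subst hvw
    have hhiggs := hS.higgs v (u (.of v) x)
    rw [LinearIsometryEquiv.symm_apply_apply] at hhiggs
    rw [QuiverRep.diracBlock_self, LinearMap.add_apply, map_add, smul_add, if_pos rfl,
      latticeHiggs, map_smul, LinearMap.smul_apply, hhiggs]
    rfl
  · have hcoord : w.coord ≠ v.coord := Ne.symm hvw
    rw [QuiverRep.diracBlock_of_ne R ρ hvw, if_neg hcoord, map_zero, LinearMap.zero_apply,
      add_zero]

theorem spectralAction_eq [NeZero m] (hS : IsLatticeSample a A h R ρ u) (ha : a ≠ 0)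
    (hA : ∀ j, IsTorusField ℓ (A j)) (f : Polynomial ℝ) :
    spectralAction f (R.dirac ρ) (1 / a) =
      blockTrace (Fin d → ZMod m) (Fin N) ℂ
        (Polynomial.aeval (latticeDirac m A h a) (f.map (algebraMap ℝ ℂ))) := by
  refine trace_aeval_eq_blockTrace (V := LoopedTorus d m) (X := latticeDirac m A h a)
    (fun v => (u v).toLinearEquiv.trans (WithLp.linearEquiv 2 ℂ (Fin N → ℂ))) (fun ψ v => ?_) _
  have hscale :
      (((1 / a : ℝ) : ℂ)⁻¹ • R.dirac ρ) ψ v = (a : ℂ) • ∑ w, R.diracBlock ρ v w (ψ w) := by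
    simp [QuiverRep.dirac]
  have hblocks : u v ((((1 / a : ℝ) : ℂ)⁻¹ • R.dirac ρ) ψ v) =
      ∑ w, Matrix.toEuclideanLin (latticeDirac m A h a v.base.coord w.base.coord) (u w (ψ w)) := by
    rw [hscale, map_smul, map_sum, Finset.smul_sum]
    exact Finset.sum_congr rfl fun w _ => hS.smul_diracBlock ha hA v.base w.base (ψ w)
  exact (congrArg (WithLp.linearEquiv 2 ℂ (Fin N → ℂ)) hblocks).trans (map_sum _ _ _)

end IsLatticeSample

/-! ## Representations are constant up to isomorphism -/

namespace PrespectralTriple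

variable {X Y : PrespectralTriple} {N : ℕ}

namespace Hom

theorem act_algMap_trans (S : Hom X Y) (x : X.A) (ψ : X.H) :
    Y.act (S.algMap x) (S.trans ψ) = S.trans (X.act x ψ) := by
  rw [S.compat, LinearIsometryEquiv.symm_apply_apply]

theorem algMap_injective (S : Hom X Y) : Function.Injective S.algMap := fun x y hxy =>
  X.faithful <| LinearMap.ext fun ψ => S.trans.injective <| by
    rw [← S.act_algMap_trans, ← S.act_algMap_trans, hxy]

/-- A morphism whose algebra map is bijective, as an isomorphism. -/
noncomputable def toIso (S : Hom X Y) (hS : Function.Bijective S.algMap) : X ≅ Y :=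
  let φ := StarAlgEquiv.ofBijective S.algMap hS
  { hom := S
    inv :=
      { algMap := (φ.symm : Y.A →⋆ₐ[ℂ] X.A)
        trans := S.trans.symm
        compat := fun y ψ => S.trans.injective <| by
          refine (S.act_algMap_trans _ _).symm.trans ?_
          rw [LinearIsometryEquiv.symm_symm, LinearIsometryEquiv.apply_symm_apply]
          exact congrArg (fun z => Y.act z (S.trans ψ)) (φ.apply_symm_apply y) }
    hom_inv_id := Hom.ext (StarAlgHom.ext φ.symm_apply_apply)
      (LinearIsometryEquiv.ext S.trans.symm_apply_apply)
    inv_hom_id := Hom.ext (StarAlgHom.ext φ.apply_symm_apply)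
      (LinearIsometryEquiv.ext S.trans.apply_symm_apply) }

theorem finrank_hilbert_eq (S : Hom X Y) : Module.finrank ℂ X.H = Module.finrank ℂ Y.H :=
  S.trans.toLinearEquiv.finrank_eq

theorem finrank_algebra_le (S : Hom X Y) : Module.finrank ℂ X.A ≤ Module.finrank ℂ Y.A :=
  LinearMap.finrank_le_finrank_of_injective
    (f := (S.algMap : X.A →ₐ[ℂ] Y.A).toLinearMap) S.algMap_injective

theorem algMap_bijective (S : Hom X Y) (hle : Module.finrank ℂ Y.A ≤ Module.finrank ℂ X.A) :
    Function.Bijective S.algMap :=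
  ⟨S.algMap_injective, (LinearMap.injective_iff_surjective_of_finrank_eq_finrank
    (S.finrank_algebra_le.antisymm hle) (f := (S.algMap : X.A →ₐ[ℂ] Y.A).toLinearMap)).1
      S.algMap_injective⟩

end Hom

theorem finrank_algebra_le_sq (X : PrespectralTriple) :
    Module.finrank ℂ X.A ≤ Module.finrank ℂ X.H * Module.finrank ℂ X.H := by
  rw [← Module.finrank_linearMap ℂ ℂ X.H X.H]
  exact LinearMap.finrank_le_finrank_of_injective
    (f := (X.act : X.A →ₐ[ℂ] Module.End ℂ X.H).toLinearMap) X.faithful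

theorem finrank_matrixTriple_hilbert : Module.finrank ℂ (matrixTriple N).H = N :=
  finrank_euclideanSpace_fin

theorem finrank_matrixTriple_algebra : Module.finrank ℂ (matrixTriple N).A = N * N :=
  (Module.finrank_matrix ℂ ℂ (Fin N) (Fin N)).trans (by simp)

/-- `M_N(ℂ)` already has the largest dimension possible for an algebra acting faithfully on `ℂ^N`,
so a morphism out of it leaves the algebra no room to grow. -/
theorem nonempty_iso_matrixTriple_of_hom (S : Hom X Y) (hX : Nonempty (X ≅ matrixTriple N)) :
    Nonempty (Y ≅ matrixTriple N) := by
  obtain ⟨i⟩ := hX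
  have hH : Module.finrank ℂ Y.H = N := by
    rw [← S.finrank_hilbert_eq, Hom.finrank_hilbert_eq i.hom, finrank_matrixTriple_hilbert]
  have hA : N * N ≤ Module.finrank ℂ X.A :=
    finrank_matrixTriple_algebra.symm.le.trans (Hom.finrank_algebra_le i.inv)
  have hle : Module.finrank ℂ Y.A ≤ Module.finrank ℂ X.A :=
    Y.finrank_algebra_le_sq.trans (by rwa [hH])
  exact ⟨(S.toIso (S.algMap_bijective hle)).symm ≪≫ i⟩

end PrespectralTriple

theorem mem_of_single_one_mem {ι : Type*} [Finite ι] [DecidableEq ι] {m : ℕ} [NeZero m]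
    {M : AddSubmonoid (ι → ZMod m)} (hM : ∀ j, Pi.single j 1 ∈ M) (g : ι → ZMod m) : g ∈ M := by
  cases nonempty_fintype ι
  rw [← Finset.univ_sum_single g]
  refine M.sum_mem fun j _ => ?_
  have hsingle : Pi.single j (g j) = (g j).val • (Pi.single j 1 : ι → ZMod m) := by
    rw [← Pi.single_smul, nsmul_eq_mul, mul_one, ZMod.natCast_zmod_val]
  rw [hsingle]
  exact M.nsmul_mem (hM j) _

theorem TorusLattice.forall_of_shift {d m : ℕ} [NeZero m] {P : TorusLattice d m → Prop}
    (hP : ∀ v j, P v → P (v.shift j)) {v₀ : TorusLattice d m} (h₀ : P v₀) (v : TorusLattice d m) :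
    P v := by
  let Q : (Fin d → ZMod m) → Prop := P
  let M : AddSubmonoid (Fin d → ZMod m) :=
    { carrier := {g | ∀ w, Q w → Q (w + g)}
      zero_mem' := fun w hw => (add_zero w).symm ▸ hw
      add_mem' := fun {g g'} hg hg' w hw => add_assoc w g g' ▸ hg' _ (hg _ hw) }
  have hsingle : ∀ j, Pi.single j 1 ∈ M := fun j w hw => coord_shift w j ▸ hP w j hw
  have hv := mem_of_single_one_mem hsingle (v.coord - v₀.coord) v₀.coord h₀
  rwa [add_sub_cancel] at hv

theorem QuiverRep.nonempty_iso_matrixTriple {d m N : ℕ} [NeZero m]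
    (R : QuiverRep (LoopedTorus d m)) {v₀ : LoopedTorus d m}
    (h₀ : Nonempty (R.obj v₀ ≅ PrespectralTriple.matrixTriple N)) (v : LoopedTorus d m) :
    Nonempty (R.obj v ≅ PrespectralTriple.matrixTriple N) :=
  TorusLattice.forall_of_shift
    (P := fun v => Nonempty (R.obj (.of v) ≅ PrespectralTriple.matrixTriple N))
    (fun v j => PrespectralTriple.nonempty_iso_matrixTriple_of_hom
      (R.map (WithLoops.old (v.edge j)))) (v₀ := v₀.base) h₀ v.base

/-! ## The smooth limit -/

section LatticeAction

open scoped Matrix Matrix.Norms.Frobenius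

variable {d m N : ℕ} {a ℓ : ℝ} {A : Fin d → MatrixField d N} {h : MatrixField d N}

/-- The Yang–Mills density `∑_{i,j} Tr_N (K_ij K_ij*)` of the lattice gauge field, where `K_ij` is
the plaquette defect. -/
noncomputable def wilsonDensity (A : Fin d → MatrixField d N) (a : ℝ) (x : Fin d → ℝ) : ℂ :=
  ∑ i, ∑ j, (plaquetteDefect (MatrixField.connection A) a i j x *
    (plaquetteDefect (MatrixField.connection A) a i j x)ᴴ).trace

/-- The kinetic density `∑_j Tr_N (K_j K_j*)` of the lattice Higgs field, where `K_j` is the lattice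
covariant derivative. -/
noncomputable def higgsDensity (A : Fin d → MatrixField d N) (h : MatrixField d N) (a : ℝ)
    (x : Fin d → ℝ) : ℂ :=
  ∑ j, (higgsDefect (MatrixField.connection A) h a j x *
    (higgsDefect (MatrixField.connection A) h a j x)ᴴ).trace

theorem isHermitian_latticeHiggs (hh : IsTorusField ℓ h) (a : ℝ) (v : Fin d → ZMod m) :
    (latticeHiggs h a v).IsHermitian :=
  (hh.hermitian _).smul (Complex.conj_ofReal a)

variable [NeZero m]

theorem latticeLink_add_single (ham : a * m = ℓ) (hA : ∀ j, IsTorusField ℓ (A j)) (i j : Fin d)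
    (v : Fin d → ZMod m) :
    latticeLink A a i (v + Pi.single j 1) =
      gaugeLink (MatrixField.connection A) a i (latticePoint a v + Pi.single j a) := by
  have hperiodic := (MatrixField.isSmoothPeriodic_connection hA i).periodic
  have hshift := periodic_latticePoint_add_single ham hperiodic v j 0
  rw [zero_add, zero_add] at hshift
  rw [latticeLink, gaugeLink, gaugeLink, hshift]

theorem latticeHiggs_add_single (ham : a * m = ℓ) (hh : IsTorusField ℓ h) (j : Fin d)
    (v : Fin d → ZMod m) :
    latticeHiggs h a (v + Pi.single j 1) = (a : ℂ) • h (latticePoint a v + Pi.single j a) := by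
  have hshift := periodic_latticePoint_add_single ham hh.isSmoothPeriodic.periodic v j 0
  rw [zero_add, zero_add] at hshift
  rw [latticeHiggs, hshift]

theorem sum_blockTrace_hop_lie_mul_lie (ham : a * m = ℓ) (hA : ∀ j, IsTorusField ℓ (A j)) :
    ∑ i, ∑ j, blockTrace (Fin d → ZMod m) (Fin N) ℂ
      (⁅hop (latticeLink (m := m) A a) (i, true), hop (latticeLink A a) (j, true)⁆ *
        ⁅hop (latticeLink (m := m) A a) (j, false), hop (latticeLink A a) (i, false)⁆) =
      ∑ v : Fin d → ZMod m, wilsonDensity A a (latticePoint a v) := by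
  simp only [blockTrace_hop_lie_mul_lie, latticeLink_add_single ham hA, wilsonDensity]
  exact (Finset.sum_congr rfl fun i _ => Finset.sum_comm).trans Finset.sum_comm

theorem sum_blockTrace_hop_lie_higgs_mul_lie (ham : a * m = ℓ) (hh : IsTorusField ℓ h) :
    ∑ j, blockTrace (Fin d → ZMod m) (Fin N) ℂ
      (⁅hop (latticeLink (m := m) A a) (j, true), blockShift 0 (latticeHiggs h a)⁆ *
        ⁅blockShift 0 (latticeHiggs (m := m) h a), hop (latticeLink A a) (j, false)⁆) =
      (a : ℂ) ^ 2 * ∑ v : Fin d → ZMod m, higgsDensity A h a (latticePoint a v) := by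
  have hdefect (j : Fin d) (v : Fin d → ZMod m) :
      latticeLink A a j v * latticeHiggs h a (v + Pi.single j 1) -
        latticeHiggs h a v * latticeLink A a j v =
      (a : ℂ) • higgsDefect (MatrixField.connection A) h a j (latticePoint a v) := by
    rw [latticeHiggs_add_single ham hh, latticeHiggs, mul_smul_comm, smul_mul_assoc, ← smul_sub]
    rfl
  simp only [blockTrace_hop_lie_onsite_mul_lie _ (isHermitian_latticeHiggs hh a), hdefect,
    higgsDensity, Matrix.conjTranspose_smul, smul_mul_smul_comm, Matrix.trace_smul,
    Complex.star_def, Complex.conj_ofReal, ← sq, smul_eq_mul, Finset.mul_sum]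
  exact Finset.sum_comm

theorem blockTrace_latticeHiggs_pow (h : MatrixField d N) (a : ℝ) (k : ℕ) :
    blockTrace (Fin d → ZMod m) (Fin N) ℂ (blockShift 0 (latticeHiggs h a) ^ k) =
      (a : ℂ) ^ k * ∑ v : Fin d → ZMod m, (h (latticePoint a v) ^ k).trace := by
  simp only [blockShift_zero_pow, blockTrace_blockShift_zero, latticeHiggs, smul_pow,
    Matrix.trace_smul, smul_eq_mul, Finset.mul_sum]

theorem blockTrace_aeval_latticeDirac (hm : 5 ≤ m) (ham : a * m = ℓ)
    (hA : ∀ j, IsTorusField ℓ (A j)) (hh : IsTorusField ℓ h) {p : Polynomial ℂ}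
    (hp : p.natDegree ≤ 4) :
    blockTrace (Fin d → ZMod m) (Fin N) ℂ (Polynomial.aeval (latticeDirac m A h a) p) =
      quarticTrace d p ((m : ℂ) ^ d * N)
        (∑ v : Fin d → ZMod m, wilsonDensity A a (latticePoint a v))
        ((a : ℂ) ^ 2 * ∑ v : Fin d → ZMod m, higgsDensity A h a (latticePoint a v))
        fun k => (a : ℂ) ^ k * ∑ v : Fin d → ZMod m, (h (latticePoint a v) ^ k).trace := by
  have hunitary (j : Fin d) (v : Fin d → ZMod m) :
      latticeLink A a j v ∈ unitary (Matrix (Fin N) (Fin N) ℂ) :=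
    MatrixField.gaugeLink_connection_mem_unitary hA a j _
  have hone : blockTrace (Fin d → ZMod m) (Fin N) ℂ 1 = (m : ℂ) ^ d * N := by
    simp [blockTrace_one]
  rw [latticeDirac, (isHoppingTrace_hop hm hunitary (latticeHiggs h a)).trace_aeval hp,
    sum_blockTrace_hop_lie_mul_lie ham hA, sum_blockTrace_hop_lie_higgs_mul_lie ham hh, hone,
    Fintype.card_fin]
  simp only [blockTrace_latticeHiggs_pow]

end LatticeAction

section SmoothLimit

open Asymptotics Filter Topology
open scoped Matrix.Norms.Frobenius

theorem quarticTrace_sub_isBigO {α : Type*} {l : Filter α} {g : α → ℝ} (d : ℕ) (p : Polynomial ℂ)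
    (c : ℂ) {W W' H H' : α → ℂ} {T T' : α → ℕ → ℂ} (hW : (fun x => W x - W' x) =O[l] g)
    (hH : (fun x => H x - H' x) =O[l] g) (hT : ∀ k ≤ 4, (fun x => T x k - T' x k) =O[l] g) :
    (fun x => quarticTrace d p c (W x) (H x) (T x) - quarticTrace d p c (W' x) (H' x) (T' x))
      =O[l] g := by
  have hsum := ((((((hW.add hH).const_mul_left (-(2 * p.coeff 4))).add
    ((hT 1 (by lia)).const_mul_left (p.coeff 1 + 6 * d * p.coeff 3))).add
    ((hT 2 (by lia)).const_mul_left (p.coeff 2 + 12 * d * p.coeff 4))).add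
    ((hT 3 (by lia)).const_mul_left (p.coeff 3))).add
    ((hT 4 (by lia)).const_mul_left (p.coeff 4)))
  refine hsum.congr_left fun x => ?_
  simp only [quarticTrace]
  ring

variable {d N : ℕ} {ℓ : ℝ} {A : Fin d → MatrixField d N} {h : MatrixField d N}

/-- The continuum action: the expansion of `Tr f (D / Λ)` up to terms of order `Λ ^ (d - 5)`. -/
noncomputable def continuumAction (f : Polynomial ℝ) (A : Fin d → MatrixField d N)
    (h : MatrixField d N) (ℓ Λ : ℝ) : ℂ :=
  (Λ : ℂ) ^ d * N *
      (f.coeff 0 + 2 * d * f.coeff 2 + (12 * d ^ 2 - 6 * d) * f.coeff 4) * (ℓ : ℂ) ^ d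
    - 2 * (Λ : ℂ) ^ ((d : ℤ) - 4) * f.coeff 4 *
        MatrixField.integralTrace ℓ (fun x => ∑ i, ∑ j, MatrixField.curvature A i j x ^ 2)
    - 2 * (Λ : ℂ) ^ ((d : ℤ) - 4) * f.coeff 4 *
        MatrixField.integralTrace ℓ (fun x => ∑ j, MatrixField.covDeriv A j h x ^ 2)
    + (Λ : ℂ) ^ ((d : ℤ) - 2) * (f.coeff 2 + 12 * d * f.coeff 4) *
        MatrixField.integralTrace ℓ (fun x => h x ^ 2)
    + (Λ : ℂ) ^ ((d : ℤ) - 4) * f.coeff 4 * MatrixField.integralTrace ℓ (fun x => h x ^ 4)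
    + (Λ : ℂ) ^ ((d : ℤ) - 1) * (f.coeff 1 + 6 * d * f.coeff 3) * MatrixField.integralTrace ℓ h
    + (Λ : ℂ) ^ ((d : ℤ) - 3) * f.coeff 3 * MatrixField.integralTrace ℓ (fun x => h x ^ 3)

theorem pow_mul_continuumAction (f : Polynomial ℝ) (A : Fin d → MatrixField d N)
    (h : MatrixField d N) (ℓ : ℝ) {a : ℝ} (ha : a ≠ 0) :
    (a : ℂ) ^ d * continuumAction f A h ℓ (1 / a) =
      quarticTrace d (f.map (algebraMap ℝ ℂ)) ((ℓ : ℂ) ^ d * N)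
        ((a : ℂ) ^ 4 *
          MatrixField.integralTrace ℓ fun x => ∑ i, ∑ j, MatrixField.curvature A i j x ^ 2)
        ((a : ℂ) ^ 4 *
          MatrixField.integralTrace ℓ fun x => ∑ j, MatrixField.covDeriv A j h x ^ 2)
        fun k => (a : ℂ) ^ k * MatrixField.integralTrace ℓ fun x => h x ^ k := by
  have ha' : (a : ℂ) ≠ 0 := Complex.ofReal_ne_zero.2 ha
  have hzpow (k : ℕ) : (a : ℂ)⁻¹ ^ ((d : ℤ) - k) = (a : ℂ)⁻¹ ^ d * (a : ℂ) ^ k := by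
    rw [zpow_sub₀ (inv_ne_zero ha'), zpow_natCast, zpow_natCast, inv_pow _ k, div_inv_eq_mul]
  have hcancel : (a : ℂ) ^ d * (a : ℂ)⁻¹ ^ d = 1 := by
    rw [← mul_pow, mul_inv_cancel₀ ha', one_pow]
  have h₁ := hzpow 1
  have h₂ := hzpow 2
  have h₃ := hzpow 3
  have h₄ := hzpow 4
  push_cast at h₁ h₂ h₃ h₄
  rw [eq_comm, ← one_mul (quarticTrace _ _ _ _ _ _), ← hcancel, mul_assoc]
  simp only [continuumAction, quarticTrace, Polynomial.coeff_map, Complex.coe_algebraMap, one_div,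
    Complex.ofReal_inv, h₁, h₂, h₃, h₄, pow_one]
  ring

theorem wilsonDensity_sub_isBigO (hℓ : 0 < ℓ) (hA : ∀ j, IsTorusField ℓ (A j)) :
    (fun p : ℕ+ × (Fin d → ℝ) => wilsonDensity A (latticeSpacing ℓ p.1) p.2 -
      latticeSpacing ℓ p.1 ^ 4 • (∑ i, ∑ j, MatrixField.curvature A i j p.2 ^ 2).trace)
      =O[atTop ×ˢ ⊤] fun p => latticeSpacing ℓ p.1 ^ 5 := by
  simp only [wilsonDensity, Matrix.trace_sum, Finset.smul_sum, ← Finset.sum_sub_distrib]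
  exact IsBigO.fun_sum fun i _ => IsBigO.fun_sum fun j _ =>
    MatrixField.trace_plaquetteDefect_isBigO hℓ hA
      ((tendsto_latticeSpacing hℓ).comp tendsto_fst) i j Prod.snd

theorem higgsDensity_sub_isBigO (hℓ : 0 < ℓ) (hA : ∀ j, IsTorusField ℓ (A j))
    (hh : IsTorusField ℓ h) :
    (fun p : ℕ+ × (Fin d → ℝ) => higgsDensity A h (latticeSpacing ℓ p.1) p.2 -
      latticeSpacing ℓ p.1 ^ 2 • (∑ j, MatrixField.covDeriv A j h p.2 ^ 2).trace)
      =O[atTop ×ˢ ⊤] fun p => latticeSpacing ℓ p.1 ^ 3 := by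
  simp only [higgsDensity, Matrix.trace_sum, Finset.smul_sum, ← Finset.sum_sub_distrib]
  exact IsBigO.fun_sum fun j _ => MatrixField.trace_higgsDefect_isBigO hℓ hA hh
    ((tendsto_latticeSpacing hℓ).comp tendsto_fst) j Prod.snd

theorem IsSmoothPeriodic.trace {M : MatrixField d N} (hM : IsSmoothPeriodic ℓ M) :
    IsSmoothPeriodic ℓ fun x => (M x).trace :=
  hM.clm_comp ((Matrix.traceLinearMap (Fin N) ℂ ℂ).restrictScalars ℝ).toContinuousLinearMap

theorem riemannSum_wilsonDensity_sub_isBigO (hℓ : 0 < ℓ) (hA : ∀ j, IsTorusField ℓ (A j)) :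
    (fun m => riemannSum ℓ m (wilsonDensity A (latticeSpacing ℓ m)) -
      (latticeSpacing ℓ m : ℂ) ^ 4 *
        MatrixField.integralTrace ℓ fun x => ∑ i, ∑ j, MatrixField.curvature A i j x ^ 2)
      =O[atTop] fun m => latticeSpacing ℓ m ^ 5 := by
  have hsmooth : IsSmoothPeriodic ℓ fun x => ∑ i, ∑ j, MatrixField.curvature A i j x ^ 2 :=
    .sum fun i _ => .sum fun j _ => (MatrixField.isSmoothPeriodic_curvature hA i j).pow 2
  refine (hsmooth.trace.riemannSum_sub_pow_smul_isBigO hℓ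
    (G := fun m => wilsonDensity A (latticeSpacing ℓ m))
    (wilsonDensity_sub_isBigO hℓ hA)).congr_left fun m => ?_
  rw [Complex.real_smul, Complex.ofReal_pow, MatrixField.integralTrace]

theorem sq_mul_riemannSum_higgsDensity_sub_isBigO (hℓ : 0 < ℓ) (hA : ∀ j, IsTorusField ℓ (A j))
    (hh : IsTorusField ℓ h) :
    (fun m => (latticeSpacing ℓ m : ℂ) ^ 2 *
        riemannSum ℓ m (higgsDensity A h (latticeSpacing ℓ m)) -
      (latticeSpacing ℓ m : ℂ) ^ 4 *
        MatrixField.integralTrace ℓ fun x => ∑ j, MatrixField.covDeriv A j h x ^ 2)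
      =O[atTop] fun m => latticeSpacing ℓ m ^ 5 := by
  have hsmooth : IsSmoothPeriodic ℓ fun x => ∑ j, MatrixField.covDeriv A j h x ^ 2 :=
    .sum fun j _ => (MatrixField.isSmoothPeriodic_covDeriv hA hh j).pow 2
  have hsum := (isBigO_refl (fun m => latticeSpacing ℓ m ^ 2) atTop).smul
    (hsmooth.trace.riemannSum_sub_pow_smul_isBigO (k := 2) hℓ
      (G := fun m => higgsDensity A h (latticeSpacing ℓ m)) (higgsDensity_sub_isBigO hℓ hA hh))
  refine hsum.congr (fun m => ?_) fun m => by rw [smul_eq_mul, ← pow_add]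
  rw [smul_sub, smul_smul, ← pow_add, Complex.real_smul, Complex.real_smul, Complex.ofReal_pow,
    Complex.ofReal_pow, MatrixField.integralTrace]

theorem pow_mul_riemannSum_trace_pow_sub_isBigO (hℓ : 0 < ℓ) (hh : IsTorusField ℓ h) {k : ℕ}
    (hk : k ≤ 4) :
    (fun m => (latticeSpacing ℓ m : ℂ) ^ k * riemannSum ℓ m (fun x => (h x ^ k).trace) -
      (latticeSpacing ℓ m : ℂ) ^ k * MatrixField.integralTrace ℓ fun x => h x ^ k)
      =O[atTop] fun m => latticeSpacing ℓ m ^ 5 := by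
  refine ((hh.isSmoothPeriodic.pow k).trace.pow_smul_riemannSum_sub_isBigO hℓ
    (Nat.lt_succ_of_le hk)).congr_left fun m => ?_
  rw [smul_sub, Complex.real_smul, Complex.real_smul, Complex.ofReal_pow,
    MatrixField.integralTrace]

theorem pow_mul_sum_latticePoint (m : ℕ+) (G : (Fin d → ℝ) → ℂ) :
    (latticeSpacing ℓ m : ℂ) ^ d * ∑ v : Fin d → ZMod m, G (latticePoint (latticeSpacing ℓ m) v) =
      riemannSum ℓ m G := by
  rw [riemannSum, Complex.real_smul, Fintype.card_fin, Complex.ofReal_pow]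

theorem pow_mul_blockTrace_aeval_latticeDirac {m : ℕ+} (hm : 5 ≤ (m : ℕ))
    (hA : ∀ j, IsTorusField ℓ (A j)) (hh : IsTorusField ℓ h) {p : Polynomial ℂ}
    (hp : p.natDegree ≤ 4) :
    (latticeSpacing ℓ m : ℂ) ^ d * blockTrace (Fin d → ZMod m) (Fin N) ℂ
      (Polynomial.aeval (latticeDirac m A h (latticeSpacing ℓ m)) p) =
      quarticTrace d p ((ℓ : ℂ) ^ d * N)
        (riemannSum ℓ m (wilsonDensity A (latticeSpacing ℓ m)))
        ((latticeSpacing ℓ m : ℂ) ^ 2 * riemannSum ℓ m (higgsDensity A h (latticeSpacing ℓ m)))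
        fun k => (latticeSpacing ℓ m : ℂ) ^ k * riemannSum ℓ m fun x => (h x ^ k).trace := by
  have hside : (latticeSpacing ℓ m : ℂ) * (m : ℕ) = ℓ := by
    exact_mod_cast congrArg Complex.ofReal (latticeSpacing_mul ℓ m)
  have hweight (k : ℕ) (G : (Fin d → ℝ) → ℂ) : (latticeSpacing ℓ m : ℂ) ^ d *
      ((latticeSpacing ℓ m : ℂ) ^ k *
        ∑ v : Fin d → ZMod m, G (latticePoint (latticeSpacing ℓ m) v)) =
      (latticeSpacing ℓ m : ℂ) ^ k * riemannSum ℓ m G := by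
    rw [mul_left_comm, pow_mul_sum_latticePoint]
  rw [blockTrace_aeval_latticeDirac hm (latticeSpacing_mul ℓ m) hA hh hp, mul_quarticTrace,
    ← mul_assoc, ← mul_pow, hside, pow_mul_sum_latticePoint, hweight]
  exact congrArg _ (funext fun k => hweight k fun x => (h x ^ k).trace)

theorem blockTrace_sub_continuumAction_isBigO (hℓ : 0 < ℓ) {f : Polynomial ℝ}
    (hf : f.natDegree ≤ 4) (hA : ∀ j, IsTorusField ℓ (A j)) (hh : IsTorusField ℓ h) :
    (fun m : ℕ+ => (latticeSpacing ℓ m : ℂ) ^ d * (blockTrace (Fin d → ZMod m) (Fin N) ℂ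
        (Polynomial.aeval (latticeDirac m A h (latticeSpacing ℓ m)) (f.map (algebraMap ℝ ℂ))) -
      continuumAction f A h ℓ (1 / latticeSpacing ℓ m)))
      =O[atTop] fun m => latticeSpacing ℓ m ^ 5 := by
  have hf' : (f.map (algebraMap ℝ ℂ)).natDegree ≤ 4 := Polynomial.natDegree_map_le.trans hf
  refine (quarticTrace_sub_isBigO d (f.map (algebraMap ℝ ℂ)) ((ℓ : ℂ) ^ d * N)
    (riemannSum_wilsonDensity_sub_isBigO hℓ hA)
    (sq_mul_riemannSum_higgsDensity_sub_isBigO hℓ hA hh)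
    (fun k hk => pow_mul_riemannSum_trace_pow_sub_isBigO hℓ hh hk)).congr' ?_ .rfl
  filter_upwards [eventually_ge_atTop (5 : ℕ+)] with m hm
  rw [mul_sub, pow_mul_blockTrace_aeval_latticeDirac hm hA hh hf',
    pow_mul_continuumAction f A h ℓ (latticeSpacing_pos hℓ m).ne']

theorem exists_norm_blockTrace_sub_continuumAction_le (hℓ : 0 < ℓ) {f : Polynomial ℝ}
    (hf : f.natDegree ≤ 4) (hA : ∀ j, IsTorusField ℓ (A j)) (hh : IsTorusField ℓ h) :
    ∃ (C : ℝ) (m₀ : ℕ), ∀ (m : ℕ) [NeZero m], m₀ ≤ m → ∀ a : ℝ, a * m = ℓ →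
      ‖blockTrace (Fin d → ZMod m) (Fin N) ℂ
          (Polynomial.aeval (latticeDirac m A h a) (f.map (algebraMap ℝ ℂ))) -
        continuumAction f A h ℓ (1 / a)‖ ≤ C * (1 / a) ^ ((d : ℤ) - 5) := by
  obtain ⟨C, hC⟩ := (blockTrace_sub_continuumAction_isBigO hℓ hf hA hh).bound
  obtain ⟨m₀, hm₀⟩ := eventually_atTop.1 hC
  refine ⟨C, m₀, fun m _ hm a ham => ?_⟩
  obtain ⟨m, rfl⟩ : ∃ k : ℕ+, (k : ℕ) = m := ⟨⟨m, NeZero.pos m⟩, rfl⟩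
  obtain rfl : a = latticeSpacing ℓ m := eq_div_of_mul_eq (Nat.cast_ne_zero.2 m.ne_zero) ham
  have ha := latticeSpacing_pos hℓ m
  have hbound := hm₀ m (PNat.coe_le_coe _ _ |>.1 hm)
  rw [norm_mul, norm_pow, Complex.norm_real, norm_pow, Real.norm_of_nonneg ha.le] at hbound
  refine le_of_mul_le_mul_left (hbound.trans_eq ?_) (pow_pos ha d)
  rw [one_div, inv_zpow', neg_sub, zpow_sub₀ ha.ne', zpow_natCast]
  field_simp

end SmoothLimit

theorem mainTheorem8_general (d N : ℕ) (ℓ : ℝ) (hℓ : 0 < ℓ)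
    (f : Polynomial ℝ) (hf : f.natDegree ≤ 4)
    (A : Fin d → MatrixField d N) (h : MatrixField d N)
    (hA : ∀ j, IsTorusField ℓ (A j)) (hh : IsTorusField ℓ h) :
    ∃ (C : ℝ) (m₀ : ℕ), ∀ (m : ℕ) [NeZero m], m₀ ≤ m → ∀ (a Λ : ℝ), a * m = ℓ → Λ = 1 / a →
      ∀ R : QuiverRep (LoopedTorus d m),
        (∀ v₀, Nonempty (R.obj v₀ ≅ PrespectralTriple.matrixTriple N) →
          ∀ v, Nonempty (R.obj v ≅ PrespectralTriple.matrixTriple N)) ∧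
        ∀ (ρ : EdgeLength (LoopedTorus d m))
          (u : ∀ v, (R.obj v).H ≃ₗᵢ[ℂ] EuclideanSpace ℂ (Fin N)),
          IsLatticeSample a A h R ρ u →
          ‖spectralAction f (R.dirac ρ) Λ - continuumAction f A h ℓ Λ‖ ≤
            C * Λ ^ ((d : ℤ) - 5) := by
  obtain ⟨C, m₀, hC⟩ := exists_norm_blockTrace_sub_continuumAction_le hℓ hf hA hh
  refine ⟨C, m₀, fun m _ hm a Λ ham hΛ R =>
    ⟨fun v₀ h₀ v => R.nonempty_iso_matrixTriple h₀ v, fun ρ u hS => ?_⟩⟩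
  have ha : a ≠ 0 := by
    rintro rfl
    exact hℓ.ne (by simpa using ham)
  subst hΛ
  rw [hS.spectralAction_eq ha hA f]
  exact hC m hm a ham

theorem mainTheorem8 (d N : ℕ) (hd : 2 ≤ d) (hN : 0 < N) (ℓ : ℝ) (hℓ : 0 < ℓ)
    (f : Polynomial ℝ) (hf : f.natDegree ≤ 4)
    (A : Fin d → MatrixField d N) (h : MatrixField d N)
    (hA : ∀ j, IsTorusField ℓ (A j)) (hh : IsTorusField ℓ h) :
    ∃ (C : ℝ) (m₀ : ℕ), ∀ (m : ℕ) [NeZero m], m₀ ≤ m → ∀ (a Λ : ℝ), a * m = ℓ → Λ = 1 / a →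
      ∀ (R : QuiverRep (LoopedTorus d m)) (v₀ : LoopedTorus d m),
        Nonempty (R.obj v₀ ≅ PrespectralTriple.matrixTriple N) →
        (∀ v, Nonempty (R.obj v ≅ PrespectralTriple.matrixTriple N)) ∧
        ∀ (ρ : EdgeLength (LoopedTorus d m))
          (u : ∀ v, (R.obj v).H ≃ₗᵢ[ℂ] EuclideanSpace ℂ (Fin N)),
          IsLatticeSample a A h R ρ u →
          ‖spectralAction f (R.dirac ρ) Λ -
            ((Λ : ℂ) ^ d * N *
                (f.coeff 0 + 2 * d * f.coeff 2 + (12 * d ^ 2 - 6 * d) * f.coeff 4) * (ℓ : ℂ) ^ d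
              - 2 * (Λ : ℂ) ^ ((d : ℤ) - 4) * f.coeff 4 *
                  MatrixField.integralTrace ℓ
                    (fun x => ∑ i, ∑ j, MatrixField.curvature A i j x ^ 2)
              - 2 * (Λ : ℂ) ^ ((d : ℤ) - 4) * f.coeff 4 *
                  MatrixField.integralTrace ℓ (fun x => ∑ j, MatrixField.covDeriv A j h x ^ 2)
              + (Λ : ℂ) ^ ((d : ℤ) - 2) * (f.coeff 2 + 12 * d * f.coeff 4) *
                  MatrixField.integralTrace ℓ (fun x => h x ^ 2)
              + (Λ : ℂ) ^ ((d : ℤ) - 4) * f.coeff 4 *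
                  MatrixField.integralTrace ℓ (fun x => h x ^ 4)
              + (Λ : ℂ) ^ ((d : ℤ) - 1) * (f.coeff 1 + 6 * d * f.coeff 3) *
                  MatrixField.integralTrace ℓ h
              + (Λ : ℂ) ^ ((d : ℤ) - 3) * f.coeff 3 *
                  MatrixField.integralTrace ℓ (fun x => h x ^ 3))‖
            ≤ C * Λ ^ ((d : ℤ) - 5) := by
  obtain ⟨C, m₀, hC⟩ := mainTheorem8_general d N ℓ hℓ f hf A h hA hh
  exact ⟨C, m₀, fun m _ hm a Λ ham hΛ R v₀ h₀ => (hC m hm a Λ ham hΛ R).imp_left fun hiso =>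
    hiso v₀ h₀⟩
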